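/- Let $N$ sensors measure $N$ independent linear processes $\mathbf x_n(t+1)=\mathbf A_n\mathbf x_n(t)+\mathbf w_n(t)$, $\mathbf y_n(t)=\mathbf C_n\mathbf x_n(t)+\mathbf v_n(t)$, where $\mathbf w_n(t)$, $\mathbf v_n(t)$ are i.i.d. zero-mean Gaussian noises, mutually independent and independent of the initial states, with covariance matrices $\mathbf W_n$, $\mathbf V_n$. Each sensor runs a local Kalman filter with output $\mathbf x^s_n(t)$. These filters are in steady state: the posterior error covariance is $\bar{\mathbf P}_n$ for all $t$, where, with $\mathbf P_n^-=\mathbf A_n\bar{\mathbf P}_n\mathbf A_n^\top+\mathbf W_n$, the matrix $\mathbf C_n\mathbf P_n^-\mathbf C_n^\top+\mathbf V_n$ is invertible, $\mathbf K_n=\mathbf P_n^-\mathbf C_n^\top(\mathbf C_n\mathbf P_n^-\mathbf C_n^\top+\mathbf V_n)^{-1}$ and $\bar{\mathbf P}_n=(\mathbf I-\mathbf K_n\mathbf C_n)\mathbf P_n^-$. They are also stable: $\rho((\mathbf I-\mathbf K_n\mathbf C_n)\mathbf A_n)<1$, where $\rho$ is the spectral radius. There are $M\ge 1$ frequency channels.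 The state $\mathbf h^{(n)}(t)\in\{0,1\}^M$ of the channels between sensor $n$ and the remote estimator (entry $1$: on, transmission succeeds; entry $0$: off, it fails) is an irreducible aperiodic Markov chain on a finite set of states $\{\mathbf h^{(n)}_1,\dots,\mathbf h^{(n)}_{\bar M^{(n)}}\}\subseteq\{0,1\}^M$ with transition probabilities $p^{(n)}_{i,j}$; the $N$ chains are independent of each other and of the processes. In each slot $t\ge1$ every sensor is assigned at most one frequency channel and every frequency channel is assigned to at most one sensor. A deterministic stationary policy makes this assignment as a function of the ages of information $(\phi_1(t),\dots,\phi_N(t))$ and of the previous channel states $(\mathbf h^{(1)}(t-1),\dots,\mathbf h^{(N)}(t-1))$. Let $\gamma_n(t)=1$ if sensor $n$ is assigned a frequency channel that is on in $\mathbf h^{(n)}(t)$, and $\gamma_n(t)=0$ otherwise. If $\gamma_n(t)=1$, then $\phi_n(t+1)=1$ and $\hat{\mathbf x}_n(t+1)=\mathbf A_n\mathbf x^s_n(t)$; if $\gamma_n(t)=0$, then $\phi_n(t+1)=\phi_n(t)+1$ and $\hat{\mathbf x}_n(t+1)=\mathbf A_n\hat{\mathbf x}_n(t)$. The initial ages $\phi_n(1)\ge1$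 are arbitrary fixed integers, with $\hat{\mathbf x}_n(1)=\mathbf A_n^{\phi_n(1)}\mathbf x^s_n(1-\phi_n(1))$. The remote estimator is called stable (average mean-square stabilizable) if some such policy makes $$J=\sum_{n=1}^N\limsup_{T\to\infty}\frac1T\sum_{t=1}^T\mathsf E\,|\hat{\mathbf x}_n(t)-\mathbf x_n(t)|^2$$ finite. For $\mathbf v=(v_1,\dots,v_{\bar M^{(n)}})\in\{1,\dots,M\}^{\bar M^{(n)}}$ let $\mathbf E^{(n)}(\mathbf v)$ be the matrix with entries $[\mathbf E^{(n)}(\mathbf v)]_{i,j}=p^{(n)}_{i,j}$ if the $v_i$-th entry of $\mathbf h^{(n)}_j$ is $0$, and $0$ otherwise. Put $$\lambda^{(n)}_L=\min_{\mathbf v_1,\dots,\mathbf v_L}\rho\bigl(\mathbf E^{(n)}(\mathbf v_1)\cdots\mathbf E^{(n)}(\mathbf v_L)\bigr)^{1/L},\qquad \lambda^{(n)}_\infty=\liminf_{L\to\infty}\lambda^{(n)}_L,\qquad \rho_{\max}=\max_n\rho(\mathbf A_n).$$ Then a necessary condition for the remote estimator to be stable is $\max_{n}\rho(\mathbf A_n)^2\lambda^{(n)}_\infty<1$,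 and a sufficient condition is $\rho_{\max}^2\max_{n}\lambda^{(n)}_\infty<1$. -/

import Mathlib

namespace RemoteEst

open MeasureTheory ProbabilityTheory Matrix Filter
open scoped ENNReal

noncomputable section

/-- The spectral radius of a real square matrix: the largest absolute value of its complex
eigenvalues. -/
def specRad {k : ℕ} (A : Matrix (Fin k) (Fin k) ℝ) : ℝ :=
  (spectralRadius ℂ (A.map (fun a : ℝ => (a : ℂ)))).toReal

/-! ### The linear time-invariant processes and their steady-state Kalman filters -/

/-- The parameters of a process `x(t+1) = A x(t) + w(t)`, `y(t) = C x(t) + v(t)`, where `w(t)` and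
`v(t)` have the covariance matrices `W` and `V`, together with a candidate `Pbar` for the
steady-state posterior error covariance of its local Kalman filter. -/
structure Plant where
  l : ℕ
  r : ℕ
  A : Matrix (Fin l) (Fin l) ℝ
  C : Matrix (Fin r) (Fin l) ℝ
  W : Matrix (Fin l) (Fin l) ℝ
  V : Matrix (Fin r) (Fin r) ℝ
  Pbar : Matrix (Fin l) (Fin l) ℝ

namespace Plant

variable (p : Plant)

/-- The prior error covariance. -/
def prior : Matrix (Fin p.l) (Fin p.l) ℝ := p.A * p.Pbar * p.Aᵀ + p.W

/-- The covariance of the innovation. -/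
def innov : Matrix (Fin p.r) (Fin p.r) ℝ := p.C * p.prior * p.Cᵀ + p.V

/-- The Kalman gain. -/
def gain : Matrix (Fin p.l) (Fin p.r) ℝ := p.prior * p.Cᵀ * p.innov⁻¹

/-- `W`, `V`, `Pbar` are covariance matrices, the local Kalman filter is well defined and stable
(its error dynamics `e(t+1) = (I - K C) A e(t) + noise` is a stable linear system), and `Pbar` is
its steady state: one prediction step followed by one update step gives back `Pbar`. -/
structure KalmanSteady : Prop where
  W_posSemidef : p.W.PosSemidef
  V_posSemidef : p.V.PosSemidef
  Pbar_posSemidef : p.Pbar.PosSemidef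
  innov_isUnit : IsUnit p.innov.det
  steady : (1 - p.gain * p.C) * p.prior = p.Pbar
  stable : specRad ((1 - p.gain * p.C) * p.A) < 1

end Plant

/-! ### The Markov channels -/

/-- The vector channel of a sensor over `M` frequency channels: it has `m` channel states, the
`i`-th of which is the vector `h i` (`true` is "on", a successful transmission, and `false` is
"off"), and transition probabilities `P i j`. -/
structure Channel (M : ℕ) where
  m : ℕ
  h : Fin m → Fin M → Bool
  P : Matrix (Fin m) (Fin m) ℝ

namespace Channel

variable {M : ℕ} (c : Channel M)

/-- The channel states are distinct, and the chain is irreducible and aperiodic: for each state,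
the possible return times have no common divisor other than `1`. -/
structure Ergodic : Prop where
  h_injective : Function.Injective c.h
  stochastic : c.P ∈ rowStochastic ℝ (Fin c.m)
  irreducible : c.P.IsIrreducible
  aperiodic : ∀ i : Fin c.m, ∀ d : ℕ,
    (∀ k : ℕ, 0 < k → 0 < (c.P ^ k) i i → d ∣ k) → d = 1

/-- The packet error probability matrix of a vector `v` of channel selections (one frequency
channel for each previous channel state). -/
def E (v : Fin c.m → Fin M) : Matrix (Fin c.m) (Fin c.m) ℝ :=
  Matrix.of fun i j => if c.h j (v i) = true then 0 else c.P i j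

/-- The least normalized spectral radius of a product of `L` packet error probability matrices. -/
def lam (L : ℕ) : ℝ :=
  ⨅ v : Fin L → Fin c.m → Fin M,
    specRad (List.ofFn fun l => c.E (v l)).prod ^ (1 / (L : ℝ))

def lamInf : ℝ := liminf c.lam atTop

end Channel

/-! ### The remote estimator -/

/-- `N` sensors with their processes and their own channels. Slot `0` is the beginning of time; the
scheduling starts with the slot `start + 1`, when the latest packet of the sensor `n` that the
remote estimator holds is the one sent in the slot `last n`; thus the initial age of information
of the sensor `n` is `start + 1 - last n`. -/
structure Setup (N M : ℕ) where
  plant : Fin N → Plant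
  chan : Fin N → Channel M
  plant_steady : ∀ n, (plant n).KalmanSteady
  chan_ergodic : ∀ n, (chan n).Ergodic
  start : ℕ
  last : Fin N → ℕ
  last_le : ∀ n, last n ≤ start

/-- The independent sources of randomness: the initial process state with the initial local
estimate, the process noise and the measurement noise in each slot, and the channel. -/
inductive Source (N : ℕ) where
  | init (n : Fin N)
  | procNoise (n : Fin N) (t : ℕ)
  | measNoise (n : Fin N) (t : ℕ)
  | channel (n : Fin N)

/-- The matrix `A` applied to the vector `z`. -/
def app {a b : ℕ} (A : Matrix (Fin a) (Fin b) ℝ) (z : EuclideanSpace ℝ (Fin b)) :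
    EuclideanSpace ℝ (Fin a) :=
  A.toEuclideanLin z

/-- The random variables of the model: process states `x n t`, local estimates `xs n t`, noises
`w n t` and `v n t`, and (indices of) channel states `ch n t`. -/
structure Vars {N M : ℕ} (S : Setup N M) (Ω : Type*) where
  x : (n : Fin N) → ℕ → Ω → EuclideanSpace ℝ (Fin (S.plant n).l)
  xs : (n : Fin N) → ℕ → Ω → EuclideanSpace ℝ (Fin (S.plant n).l)
  w : (n : Fin N) → ℕ → Ω → EuclideanSpace ℝ (Fin (S.plant n).l)
  v : (n : Fin N) → ℕ → Ω → EuclideanSpace ℝ (Fin (S.plant n).r)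
  ch : (n : Fin N) → ℕ → Ω → Fin (S.chan n).m

namespace Vars

variable {N M : ℕ} {S : Setup N M} {Ω : Type*} (X : Vars S Ω)

/-- The measurements. -/
def y (n : Fin N) (t : ℕ) (ω : Ω) : EuclideanSpace ℝ (Fin (S.plant n).r) :=
  app (S.plant n).C (X.x n t ω) + X.v n t ω

/-- The σ-algebra generated by a source of randomness. -/
@[reducible] def sigma : Source N → MeasurableSpace Ω
  | .init n => MeasurableSpace.comap (X.x n 0) inferInstance ⊔
      MeasurableSpace.comap (X.xs n 0) inferInstance
  | .procNoise n t => MeasurableSpace.comap (X.w n t) inferInstance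
  | .measNoise n t => MeasurableSpace.comap (X.v n t) inferInstance
  | .channel n => ⨆ t, MeasurableSpace.comap (X.ch n t) inferInstance

/-- The random variables follow the model: the processes obey the linear dynamics, the local
estimates are those of the steady-state Kalman filter, the noises are zero-mean Gaussian, the
channel states form Markov chains with the given transition probabilities (and any initial law),
and all the sources of randomness are independent. -/
structure IsModel [MeasurableSpace Ω] (μ : Measure Ω) : Prop where
  measurable_x_zero : ∀ n, Measurable (X.x n 0)
  measurable_xs_zero : ∀ n, Measurable (X.xs n 0)
  measurable_w : ∀ n t, Measurable (X.w n t)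
  measurable_v : ∀ n t, Measurable (X.v n t)
  measurable_ch : ∀ n t, Measurable (X.ch n t)
  dynamics : ∀ n t ω, X.x n (t + 1) ω = app (S.plant n).A (X.x n t ω) + X.w n t ω
  kalman : ∀ n t ω, X.xs n (t + 1) ω = app (S.plant n).A (X.xs n t ω) +
    app (S.plant n).gain
      (X.y n (t + 1) ω - app (S.plant n).C (app (S.plant n).A (X.xs n t ω)))
  init_memLp : ∀ n, MemLp (fun ω => X.xs n 0 ω - X.x n 0 ω) 2 μ
  init_cov : ∀ n i j,
    ∫ ω, (X.xs n 0 ω - X.x n 0 ω) i * (X.xs n 0 ω - X.x n 0 ω) j ∂μ = (S.plant n).Pbar i j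
  law_w : ∀ n t, μ.map (X.w n t) = multivariateGaussian 0 (S.plant n).W
  law_v : ∀ n t, μ.map (X.v n t) = multivariateGaussian 0 (S.plant n).V
  markov : ∀ n t (s : ℕ → Fin (S.chan n).m),
    μ {ω | ∀ k ≤ t + 1, X.ch n k ω = s k} =
      μ {ω | ∀ k ≤ t, X.ch n k ω = s k} * ENNReal.ofReal ((S.chan n).P (s t) (s (t + 1)))
  indep : iIndep X.sigma μ

end Vars

/-- A deterministic stationary scheduling policy: from the current ages of information and the
previous channel states of all sensors it selects for each sensor one frequency channel or none
(`none`), such that each frequency channel carries the packet of at most one sensor. -/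
structure Policy {N M : ℕ} (S : Setup N M) where
  sel : (Fin N → ℕ) → ((n : Fin N) → Fin (S.chan n).m) → Fin N → Option (Fin M)
  exclusive : ∀ φ h n n' m, sel φ h n = some m → sel φ h n' = some m → n = n'

namespace Vars

variable {N M : ℕ} {S : Setup N M} {Ω : Type*} (X : Vars S Ω) (π : Policy S)

/-- With `aoi` the ages of information in the slot `t + 1`: the packet of the sensor `n` is received
in the slot `t + 1`, that is, it is scheduled on a frequency channel that is on. -/
def received (aoi : Fin N → ℕ) (t : ℕ) (ω : Ω) (n : Fin N) : Bool :=
  match π.sel aoi (fun n' => X.ch n' t ω) n with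
  | none => false
  | some m => (S.chan n).h (X.ch n (t + 1) ω) m

/-- The ages of information in the slot `start + 1 + k`. -/
def aoi (ω : Ω) : ℕ → Fin N → ℕ
  | 0 => fun n => S.start + 1 - S.last n
  | k + 1 => fun n =>
      if X.received π (aoi ω k) (S.start + k) ω n = true then 1 else aoi ω k n + 1

/-- The remote estimates in the slot `start + 1 + k`. -/
def xhat (n : Fin N) (ω : Ω) : ℕ → EuclideanSpace ℝ (Fin (S.plant n).l)
  | 0 => app ((S.plant n).A ^ (S.start + 1 - S.last n)) (X.xs n (S.last n) ω)
  | k + 1 =>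
      if X.received π (X.aoi π ω k) (S.start + k) ω n = true then
        app (S.plant n).A (X.xs n (S.start + 1 + k) ω)
      else app (S.plant n).A (xhat n ω k)

/-- The mean-square error of the remote estimate of the process `n` in the slot `start + 1 + k`,
that is, the trace of the error covariance matrix. -/
def mse [MeasurableSpace Ω] (μ : Measure Ω) (n : Fin N) (k : ℕ) : ℝ≥0∞ :=
  ∫⁻ ω, ‖X.xhat π n ω k - X.x n (S.start + 1 + k) ω‖ₑ ^ 2 ∂μ

/-- The long-term average mean-square error of the process `n`. -/
def cost [MeasurableSpace Ω] (μ : Measure Ω) (n : Fin N) : ℝ≥0∞ :=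
  limsup (fun T : ℕ => (∑ k ∈ Finset.range T, X.mse π μ n k) / (T : ℝ≥0∞)) atTop

/-- Average mean-square stabilizability: some deterministic stationary policy makes the sum of the
average mean-square errors finite. -/
def Stabilizable [MeasurableSpace Ω] (μ : Measure Ω) : Prop :=
  ∃ π : Policy S, ∑ n, X.cost π μ n < ⊤

end Vars

end

end RemoteEst

namespace RemoteEst

open MeasureTheory ProbabilityTheory Matrix Filter
open scoped ENNReal

/-! Packet errors depend only on initial data and noises, ages of information only on the channels,
and these are independent. So the mean-square error is the expectation of `(errCov j).trace` at the
random age `j` (`mse_eq`). Moreover `errCov j` is `Pbar` plus the sum over `i < j` of `A ^ i * (Bᵀ *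
B) * (A ^ i)ᵀ`. Its trace is at most a constant times a geometric sum of any ratio `γ > ρ(A)²`. If
`ρ(A) ≥ 1`, it is at least a constant times the geometric sum of ratio `ρ(A)²`, because stability of
the local filter forbids `B` to kill an unstable eigenvector of `Aᵀ`.

The channel enters through `failProb k`, the least probability of `k` failures in a row, obtained by
dynamic programming. A bound `failProb k ≤ θ ^ k` at one `k > 0` gives `lamInf ≤ θ`; conversely
`lamInf < q` gives `failProb k < q ^ k` for some `k > 0`.

Necessity: no policy fails less often than `failProb`. If for every `k` some channel state had
`ρ(A)^(2k) * failProb k ≥ 1`, every `k` would add a fixed amount to the error over a window of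
bounded length, since an irreducible chain visits each state there with positive probability. The
average error would be infinite. So the product is below one at some `k`, whence `ρ(A)² * lamInf <
1` (`specRad_sq_mul_lamInf_lt_one`).

Sufficiency: for `q > lamInf` a selection depending only on the previous channel state contracts a
positive vector `W` at rate `q` (`exists_contracting`). Always serving the oldest sensor with its
own selection admits a Lyapunov function: `W` of that sensor times a sum of `B ^ rank * γ ^ age`. A
failure multiplies the sum by `γ`, which the contraction of `W` offsets as `γ * q < 1`; a success
lowers the rank of every other sensor, which gains a factor `1 / B` (`next_lyapunov_le`). For large
`B` the expected exponentials of the ages stay bounded. -/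

lemma exists_le_mul_pow_of_eventually {r : ℝ} (hr : 0 < r) {f : ℕ → ℝ}
    (h : ∀ᶠ n in atTop, f n ≤ r ^ n) : ∃ C : ℝ, 0 < C ∧ ∀ n, f n ≤ C * r ^ n := by
  obtain ⟨n₀, hn₀⟩ := eventually_atTop.1 h
  refine ⟨1 + ∑ n ∈ Finset.range n₀, |f n| / r ^ n, by positivity, fun n => ?_⟩
  have hS : 0 ≤ ∑ n ∈ Finset.range n₀, |f n| / r ^ n := by positivity
  have hrn : 0 < r ^ n := by positivity
  by_cases hn : n₀ ≤ n
  · nlinarith [hn₀ n hn]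
  · have h1 : |f n| / r ^ n ≤ ∑ n ∈ Finset.range n₀, |f n| / r ^ n :=
      Finset.single_le_sum (f := fun n => |f n| / r ^ n) (fun _ _ => by positivity)
        (Finset.mem_range.2 (by omega))
    rw [div_le_iff₀ hrn] at h1
    nlinarith [le_abs_self (f n)]

/-! ### Spectral radii of real matrices. -/

section SpectralRadius

attribute [local instance] Matrix.linftyOpNormedRing Matrix.linftyOpNormedAlgebra

lemma specRad_nonneg {k : ℕ} (A : Matrix (Fin k) (Fin k) ℝ) : 0 ≤ specRad A :=
  ENNReal.toReal_nonneg

lemma spectralRadius_ne_top {k : ℕ} (A : Matrix (Fin k) (Fin k) ℂ) :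
    spectralRadius ℂ A ≠ ⊤ := by
  have h := spectrum.spectralRadius_le_pow_nnnorm_pow_one_div ℂ A 0
  refine ne_top_of_le_ne_top ?_ h
  finiteness

lemma norm_map_ofReal_le {k : ℕ} {A : Matrix (Fin k) (Fin k) ℝ} {c : ℝ} (hc : 0 ≤ c)
    (h : ∀ i, ∑ j, |A i j| ≤ c) : ‖A.map (fun a : ℝ => (a : ℂ))‖ ≤ c := by
  rw [Matrix.linfty_opNorm_def]
  lift c to NNReal using hc
  rw [NNReal.coe_le_coe]
  refine Finset.sup_le fun i _ => ?_
  rw [← NNReal.coe_le_coe]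
  simpa using h i

lemma abs_apply_le_norm_map_ofReal {k : ℕ} (A : Matrix (Fin k) (Fin k) ℝ) (i j : Fin k) :
    |A i j| ≤ ‖A.map (fun a : ℝ => (a : ℂ))‖ := by
  have h1 : ∑ j', ‖(A.map (fun a : ℝ => (a : ℂ))) i j'‖₊ ≤
      ‖A.map (fun a : ℝ => (a : ℂ))‖₊ := by
    rw [Matrix.linfty_opNNNorm_def]
    exact Finset.le_sup (f := fun i => ∑ j', ‖(A.map (fun a : ℝ => (a : ℂ))) i j'‖₊)
      (Finset.mem_univ i)
  have h2 : ‖(A.map (fun a : ℝ => (a : ℂ))) i j‖₊ ≤ _ :=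
    (Finset.single_le_sum (f := fun j' => ‖(A.map (fun a : ℝ => (a : ℂ))) i j'‖₊)
      (fun _ _ => bot_le) (Finset.mem_univ j)).trans h1
  have h3 := NNReal.coe_le_coe.2 h2
  simpa using h3

lemma map_ofReal_pow {k : ℕ} (A : Matrix (Fin k) (Fin k) ℝ) (n : ℕ) :
    (A ^ n).map (fun a : ℝ => (a : ℂ)) = (A.map (fun a : ℝ => (a : ℂ))) ^ n := by
  have := map_pow (Complex.ofRealHom.mapMatrix (m := Fin k)) A n
  exact this

/-- Gelfand's formula, entrywise. -/
lemma exists_abs_pow_apply_le {k : ℕ} {A : Matrix (Fin k) (Fin k) ℝ} {r : ℝ}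
    (hr : specRad A < r) : ∃ C : ℝ, 0 < C ∧ ∀ n a b, |(A ^ n) a b| ≤ C * r ^ n := by
  have hr0 : 0 < r := (specRad_nonneg A).trans_lt hr
  set B := A.map (fun a : ℝ => (a : ℂ)) with hB
  have hlt : spectralRadius ℂ B < ENNReal.ofReal r :=
    (ENNReal.lt_ofReal_iff_toReal_lt (spectralRadius_ne_top B)).2 hr
  have hev := (spectrum.pow_norm_pow_one_div_tendsto_nhds_spectralRadius B).eventually
    (gt_mem_nhds hlt)
  obtain ⟨n₀, hn₀⟩ := eventually_atTop.1 hev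
  -- The range starts at `n₀ + 1` to exclude `n = 0`, where the root cannot be undone.
  have hbd : ∀ n, n₀ + 1 ≤ n → ‖B ^ n‖ ≤ r ^ n := by
    intro n hn
    have h1 := hn₀ n (by omega)
    have hn' : (n : ℝ) ≠ 0 := by
      have : n ≠ 0 := by omega
      exact_mod_cast this
    rw [ENNReal.ofReal_lt_ofReal_iff hr0] at h1
    have h2 := pow_le_pow_left₀ (by positivity) h1.le n
    rwa [← Real.rpow_natCast, ← Real.rpow_mul (norm_nonneg _), one_div_mul_cancel hn',
      Real.rpow_one] at h2
  obtain ⟨C, hC, h⟩ := exists_le_mul_pow_of_eventually hr0 (f := fun n => ‖B ^ n‖)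
    (eventually_atTop.2 ⟨n₀ + 1, hbd⟩)
  refine ⟨C, hC, fun n a b => le_trans ?_ (h n)⟩
  rw [hB, ← map_ofReal_pow]
  exact abs_apply_le_norm_map_ofReal _ _ _

lemma specRad_le_of_row_sum_le {k : ℕ} {A : Matrix (Fin k) (Fin k) ℝ} {c : ℝ} (hc : 0 ≤ c)
    (h : ∀ i, ∑ j, |A i j| ≤ c) : specRad A ≤ c := by
  rcases Nat.eq_zero_or_pos k with rfl | hk
  · refine le_trans (le_of_eq ?_) hc
    unfold specRad
    rw [ENNReal.toReal_eq_zero_iff]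
    left
    exact spectrum.SpectralRadius.of_subsingleton _
  · have : Nonempty (Fin k) := ⟨⟨0, hk⟩⟩
    have : NormOneClass (Matrix (Fin k) (Fin k) ℂ) := Matrix.linfty_opNormOneClass
    refine ENNReal.toReal_le_of_le_ofReal hc ?_
    refine (spectrum.spectralRadius_le_nnnorm _).trans ?_
    rw [← ENNReal.ofReal_coe_nnreal, coe_nnnorm]
    exact ENNReal.ofReal_le_ofReal (norm_map_ofReal_le hc h)

/-- The transpose is taken because covariances evolve by `A * · * Aᵀ`, so that quadratic forms see
the powers of `Aᵀ`. Both matrices have the same characteristic polynomial. -/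
lemma exists_eigenvector_transpose {k : ℕ} {A : Matrix (Fin k) (Fin k) ℝ}
    (hA : 0 < specRad A) : ∃ (z : ℂ) (u : Fin k → ℂ), ‖z‖ = specRad A ∧ u ≠ 0 ∧
      (A.map (fun a : ℝ => (a : ℂ)))ᵀ *ᵥ u = z • u := by
  rcases Nat.eq_zero_or_pos k with rfl | hk
  · have := specRad_le_of_row_sum_le (A := A) le_rfl (fun i => i.elim0)
    linarith
  have : Nonempty (Fin k) := ⟨⟨0, hk⟩⟩
  obtain ⟨z, hz, hz'⟩ := spectrum.exists_nnnorm_eq_spectralRadius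
    (A.map (fun a : ℝ => (a : ℂ)))
  have hz2 : z ∈ spectrum ℂ (A.map (fun a : ℝ => (a : ℂ)))ᵀ := by
    rw [Matrix.mem_spectrum_iff_isRoot_charpoly] at hz ⊢
    rwa [Matrix.charpoly_transpose]
  rw [← Matrix.spectrum_toLin', ← Module.End.hasEigenvalue_iff_mem_spectrum] at hz2
  obtain ⟨u, hu⟩ := hz2.exists_hasEigenvector
  refine ⟨z, u, ?_, hu.2, ?_⟩
  · simp [specRad, ← hz']
  · simpa using hu.apply_eq_smul

lemma norm_le_specRad_of_eigenvector_transpose {k : ℕ} {A : Matrix (Fin k) (Fin k) ℝ}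
    {z : ℂ} {u : Fin k → ℂ} (hu : u ≠ 0)
    (h : (A.map (fun a : ℝ => (a : ℂ)))ᵀ *ᵥ u = z • u) : ‖z‖ ≤ specRad A := by
  have hz2 : z ∈ spectrum ℂ (A.map (fun a : ℝ => (a : ℂ)))ᵀ := by
    rw [← Matrix.spectrum_toLin', ← Module.End.hasEigenvalue_iff_mem_spectrum]
    refine Module.End.hasEigenvalue_of_hasEigenvector (x := u) ⟨?_, hu⟩
    rw [Module.End.mem_eigenspace_iff]
    simpa using h
  have hz : z ∈ spectrum ℂ (A.map (fun a : ℝ => (a : ℂ))) := by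
    rw [Matrix.mem_spectrum_iff_isRoot_charpoly] at hz2 ⊢
    rwa [Matrix.charpoly_transpose] at hz2
  have h1 : (‖z‖₊ : ℝ≥0∞) ≤ spectralRadius ℂ (A.map (fun a : ℝ => (a : ℂ))) :=
    le_iSup₂ (f := fun (z : ℂ) (_ : z ∈ spectrum ℂ (A.map (fun a : ℝ => (a : ℂ)))) =>
      (‖z‖₊ : ℝ≥0∞)) z hz
  have h2 := ENNReal.toReal_mono (spectralRadius_ne_top _) h1
  simpa [specRad] using h2

end SpectralRadius

lemma exists_pos_forall_le {ι : Type*} [Finite ι] {f : ι → ℝ} (hf : ∀ i, 0 < f i) :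
    ∃ b : ℝ, 0 < b ∧ ∀ i, b ≤ f i := by
  rcases isEmpty_or_nonempty ι with h | h
  · exact ⟨1, one_pos, fun i => h.elim i⟩
  · obtain ⟨i, hi⟩ := exists_eq_ciInf_of_finite (f := f)
    exact ⟨f i, hf i, fun j => hi ▸ ciInf_le (Set.finite_range _).bddBelow j⟩

/-! ### Consecutive failures on one Markov channel and the constant `lamInf`. -/

namespace Channel

variable {M : ℕ} (c : Channel M)

lemma Ergodic.P_nonneg {c : Channel M} (hc : c.Ergodic) (i j : Fin c.m) : 0 ≤ c.P i j :=
  nonneg_of_mem_rowStochastic hc.stochastic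

lemma Ergodic.sum_P {c : Channel M} (hc : c.Ergodic) (i : Fin c.m) : ∑ j, c.P i j = 1 :=
  sum_row_of_mem_rowStochastic hc.stochastic i

/-- The expectation of `x` at the next channel state on the event that a transmission over the
frequency channel `a` fails. -/
noncomputable def failMean (x : Fin c.m → ℝ) (i : Fin c.m) (a : Fin M) : ℝ :=
  ∑ j, (if c.h j a = true then 0 else c.P i j) * x j

/-- The Bellman operator of the minimization of the probability of consecutive failures. -/
noncomputable def bellman (x : Fin c.m → ℝ) (i : Fin c.m) : ℝ := ⨅ a, c.failMean x i a

lemma E_mulVec (v : Fin c.m → Fin M) (x : Fin c.m → ℝ) (i : Fin c.m) :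
    (c.E v *ᵥ x) i = c.failMean x i (v i) := rfl

lemma bellman_le (x : Fin c.m → ℝ) (i : Fin c.m) (a : Fin M) :
    c.bellman x i ≤ c.failMean x i a :=
  ciInf_le (Set.finite_range _).bddBelow a

lemma exists_bellman_eq [NeZero M] (x : Fin c.m → ℝ) :
    ∃ v, c.E v *ᵥ x = c.bellman x := by
  choose v hv using fun i => exists_eq_ciInf_of_finite (f := c.failMean x i)
  exact ⟨v, funext hv⟩

variable {c}

lemma Ergodic.failMean_mono (hc : c.Ergodic) {x y : Fin c.m → ℝ} (h : x ≤ y) (i : Fin c.m)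
    (a : Fin M) : c.failMean x i a ≤ c.failMean y i a := by
  refine Finset.sum_le_sum fun j _ => mul_le_mul_of_nonneg_left (h j) ?_
  split_ifs
  exacts [le_rfl, hc.P_nonneg i j]

lemma Ergodic.failMean_const_le (hc : c.Ergodic) {b : ℝ} (hb : 0 ≤ b) (i : Fin c.m)
    (a : Fin M) : c.failMean (fun _ => b) i a ≤ b := by
  calc c.failMean (fun _ => b) i a ≤ ∑ j, c.P i j * b := by
        refine Finset.sum_le_sum fun j _ => mul_le_mul_of_nonneg_right ?_ hb
        split_ifs
        exacts [hc.P_nonneg i j, le_rfl]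
    _ = b := by rw [← Finset.sum_mul, hc.sum_P, one_mul]

lemma failMean_add (x y : Fin c.m → ℝ) (i : Fin c.m) (a : Fin M) :
    c.failMean (x + y) i a = c.failMean x i a + c.failMean y i a := by
  simp [failMean, mul_add, Finset.sum_add_distrib]

lemma failMean_smul (b : ℝ) (x : Fin c.m → ℝ) (i : Fin c.m) (a : Fin M) :
    c.failMean (b • x) i a = b * c.failMean x i a := by
  simp only [failMean, Finset.mul_sum, Pi.smul_apply, smul_eq_mul]
  exact Finset.sum_congr rfl fun j _ => by ring

lemma Ergodic.failMean_nonneg (hc : c.Ergodic) {x : Fin c.m → ℝ} (hx : 0 ≤ x) (i : Fin c.m)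
    (a : Fin M) : 0 ≤ c.failMean x i a := by
  have := hc.failMean_mono hx i a
  simpa [failMean] using this

lemma Ergodic.bellman_mono [NeZero M] (hc : c.Ergodic) {x y : Fin c.m → ℝ} (h : x ≤ y) :
    c.bellman x ≤ c.bellman y :=
  fun i => le_ciInf fun a => (c.bellman_le x i a).trans (hc.failMean_mono h i a)

lemma Ergodic.bellman_nonneg [NeZero M] (hc : c.Ergodic) {x : Fin c.m → ℝ} (h : 0 ≤ x) :
    0 ≤ c.bellman x :=
  fun i => le_ciInf fun a => hc.failMean_nonneg h i a

lemma Ergodic.bellman_add_const_le [NeZero M] (hc : c.Ergodic) (x : Fin c.m → ℝ) {b : ℝ}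
    (hb : 0 ≤ b) : c.bellman (x + fun _ => b) ≤ c.bellman x + fun _ => b := by
  obtain ⟨v, hv⟩ := c.exists_bellman_eq x
  intro i
  rw [← hv]
  refine (c.bellman_le _ i (v i)).trans ?_
  rw [failMean_add]
  exact add_le_add le_rfl (hc.failMean_const_le hb i _)

/-- The least probability of `k` consecutive failures, as a function of the channel state. -/
noncomputable def failProb (c : Channel M) (k : ℕ) : Fin c.m → ℝ := c.bellman^[k] 1

lemma failProb_zero : c.failProb 0 = 1 := rfl

lemma failProb_succ (k : ℕ) : c.failProb (k + 1) = c.bellman (c.failProb k) :=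
  Function.iterate_succ_apply' _ _ _

lemma Ergodic.failProb_nonneg [NeZero M] (hc : c.Ergodic) (k : ℕ) : 0 ≤ c.failProb k := by
  induction k with
  | zero => exact zero_le_one
  | succ k ih => rw [failProb_succ]; exact hc.bellman_nonneg ih

lemma Ergodic.prod_nonneg (hc : c.Ergodic) (l : List (Fin c.m → Fin M)) (i j : Fin c.m) :
    0 ≤ (l.map c.E).prod i j := by
  induction l generalizing i j with
  | nil =>
    simp only [List.map_nil, List.prod_nil, Matrix.one_apply]
    split_ifs <;> norm_num
  | cons v l ih =>
    rw [List.map_cons, List.prod_cons, Matrix.mul_apply]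
    refine Finset.sum_nonneg fun k _ => mul_nonneg ?_ (ih k j)
    simp only [E, of_apply]
    split_ifs
    exacts [le_rfl, hc.P_nonneg i k]

lemma mulVec_le_mulVec {k : ℕ} {A : Matrix (Fin k) (Fin k) ℝ} (hA : ∀ i j, 0 ≤ A i j)
    {x y : Fin k → ℝ} (h : x ≤ y) : A *ᵥ x ≤ A *ᵥ y :=
  fun i => Finset.sum_le_sum (s := Finset.univ) fun j _ =>
    mul_le_mul_of_nonneg_left (h j) (hA i j)

/-- Backward minimization does at least as well as any prescribed sequence of selections, since
`bellman` is monotone. -/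
lemma Ergodic.failProb_le_prod [NeZero M] (hc : c.Ergodic) (l : List (Fin c.m → Fin M)) :
    c.failProb l.length ≤ (l.map c.E).prod *ᵥ 1 := by
  induction l with
  | nil => simp [failProb_zero]
  | cons v l ih =>
    rw [List.length_cons, failProb_succ, List.map_cons, List.prod_cons, ← mulVec_mulVec]
    intro i
    refine (hc.bellman_mono ih i).trans ?_
    rw [E_mulVec]
    exact c.bellman_le _ i _

lemma exists_failProb_eq_prod [NeZero M] (c : Channel M) (k : ℕ) :
    ∃ l : List (Fin c.m → Fin M), l.length = k ∧ (l.map c.E).prod *ᵥ 1 = c.failProb k := by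
  induction k with
  | zero => exact ⟨[], rfl, by simp [failProb_zero]⟩
  | succ k ih =>
    obtain ⟨l, hl, h⟩ := ih
    obtain ⟨v, hv⟩ := c.exists_bellman_eq (c.failProb k)
    exact ⟨v :: l, by simp [hl], by
      rw [List.map_cons, List.prod_cons, ← mulVec_mulVec, h, hv, failProb_succ]⟩

/-- For a nonnegative matrix, `A *ᵥ 1` lists the absolute row sums, whose maximum is an operator
norm. -/
lemma specRad_le_of_mulVec_one_le {k : ℕ} {A : Matrix (Fin k) (Fin k) ℝ}
    (hA : ∀ i j, 0 ≤ A i j) {b : ℝ} (hb : 0 ≤ b) (h : A *ᵥ 1 ≤ fun _ => b) : specRad A ≤ b := by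
  refine specRad_le_of_row_sum_le hb fun i => ?_
  have := h i
  simp only [mulVec, dotProduct_one] at this
  simpa [abs_of_nonneg (hA i _)] using this

lemma pow_mulVec_one_le {k : ℕ} {A : Matrix (Fin k) (Fin k) ℝ}
    (hA : ∀ i j, 0 ≤ A i j) {b : ℝ} (hb : 0 ≤ b) (h : A *ᵥ 1 ≤ fun _ => b) (n : ℕ) :
    A ^ n *ᵥ 1 ≤ fun _ => b ^ n := by
  induction n with
  | zero => simp [Pi.le_def]
  | succ n ih =>
    rw [pow_succ', ← mulVec_mulVec]
    refine (mulVec_le_mulVec hA ih).trans ?_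
    have h1 : (fun _ : Fin k => b ^ n) = b ^ n • (1 : Fin k → ℝ) := by
      ext; simp
    rw [h1, mulVec_smul]
    intro i
    have := mul_le_mul_of_nonneg_left (h i) (pow_nonneg hb n)
    simpa [pow_succ] using this

lemma lam_nonneg [NeZero M] (c : Channel M) (L : ℕ) : 0 ≤ c.lam L :=
  le_ciInf fun _ => Real.rpow_nonneg (specRad_nonneg _) _

lemma lam_length_le (c : Channel M) (l : List (Fin c.m → Fin M)) :
    c.lam l.length ≤ specRad (l.map c.E).prod ^ (1 / (l.length : ℝ)) := by
  refine (ciInf_le (Set.finite_range _).bddBelow l.get).trans (le_of_eq ?_)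
  congr 3
  conv_rhs => rw [← List.ofFn_get l, List.map_ofFn]
  rfl

/-- An optimal word of `k` selections, repeated periodically, has row sums at most `θ ^ k` per
period. This controls `lam` along the multiples of `k`, which suffices for a liminf. -/
lemma Ergodic.lamInf_le_of_failProb_le [NeZero M] (hc : c.Ergodic) {k : ℕ} (hk : 0 < k) {θ : ℝ}
    (hθ : 0 ≤ θ) (h : ∀ i, c.failProb k i ≤ θ ^ k) : c.lamInf ≤ θ := by
  obtain ⟨l, hl, hp⟩ := c.exists_failProb_eq_prod k
  have hbdd : IsBoundedUnder (· ≥ ·) atTop c.lam :=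
    isBoundedUnder_of ⟨0, fun L => c.lam_nonneg L⟩
  refine liminf_le_of_frequently_le (frequently_atTop.2 fun n => ?_) hbdd
  refine ⟨k * (n + 1), by nlinarith, ?_⟩
  set l' := (List.replicate (n + 1) l).flatten
  have hlen : l'.length = k * (n + 1) := by
    simp [l', hl, mul_comm]
  have hprod : (l'.map c.E).prod = (l.map c.E).prod ^ (n + 1) := by
    simp [l', List.map_flatten, List.prod_flatten]
  have h1 := c.lam_length_le l'
  rw [hprod, hlen] at h1
  have h2 : specRad ((l.map c.E).prod ^ (n + 1)) ≤ (θ ^ k) ^ (n + 1) := by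
    refine specRad_le_of_mulVec_one_le ?_ (by positivity)
      (pow_mulVec_one_le (hc.prod_nonneg l) (by positivity) (by rw [hp]; exact h) _)
    rw [← hprod]
    exact hc.prod_nonneg l'
  refine h1.trans ((Real.rpow_le_rpow (specRad_nonneg _) h2 (by positivity)).trans (le_of_eq ?_))
  rw [← pow_mul, ← Real.rpow_natCast, ← Real.rpow_mul hθ, mul_one_div_cancel, Real.rpow_one]
  positivity

/-- Always using frequency channel `0` gives substochastic matrices. Besides the bound on `lamInf`,
this supplies the coboundedness that a real-valued liminf needs. -/
lemma Ergodic.lam_le_one [NeZero M] (hc : c.Ergodic) (L : ℕ) : c.lam L ≤ 1 := by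
  have h1 : ∀ i, c.failProb 1 i ≤ 1 := fun i =>
    (c.bellman_le _ i 0).trans (hc.failMean_const_le zero_le_one i 0)
  let l : List (Fin c.m → Fin M) := List.replicate L 0
  have hl : l.length = L := by simp [l]
  have h2 := c.lam_length_le l
  rw [hl] at h2
  refine h2.trans (Real.rpow_le_one (specRad_nonneg _) ?_ (by positivity))
  have h3 : (l.map c.E).prod = ([(0 : Fin c.m → Fin M)].map c.E).prod ^ L := by
    simp [l]
  rw [h3]
  refine specRad_le_of_mulVec_one_le ?_ zero_le_one ?_
  · rw [← h3]
    exact hc.prod_nonneg l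
  · have := pow_mulVec_one_le (hc.prod_nonneg [0]) zero_le_one (n := L) (fun i => ?_)
    · simpa using this
    · simp only [List.map_cons, List.map_nil, List.prod_cons, List.prod_nil, mul_one]
      exact hc.failMean_const_le zero_le_one i 0

lemma Ergodic.lamInf_nonneg [NeZero M] (hc : c.Ergodic) : 0 ≤ c.lamInf :=
  le_liminf_of_le (isCoboundedUnder_ge_of_le atTop hc.lam_le_one)
    (Eventually.of_forall c.lam_nonneg)

lemma Ergodic.lamInf_le_one [NeZero M] (hc : c.Ergodic) : c.lamInf ≤ 1 :=
  liminf_le_of_frequently_le (Eventually.of_forall hc.lam_le_one).frequently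
    (isBoundedUnder_of ⟨0, fun L => c.lam_nonneg L⟩)

/-- Some word of length `L` has a product of spectral radius below `q ^ L`. By Gelfand's formula its
powers decay faster than `q ^ (L * n)`, so a large `n` absorbs the constant and the dimension. -/
lemma Ergodic.exists_failProb_lt [NeZero M] (hc : c.Ergodic) {q : ℝ} (hq : c.lamInf < q) :
    ∃ k, 0 < k ∧ ∀ i, c.failProb k i < q ^ k := by
  have hq0 : 0 < q := hc.lamInf_nonneg.trans_lt hq
  have hfr := frequently_lt_of_liminf_lt (isCoboundedUnder_ge_of_le atTop hc.lam_le_one) hq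
  obtain ⟨L, hL, hL0⟩ := (hfr.and_eventually (eventually_gt_atTop 0)).exists
  obtain ⟨v, hv⟩ := exists_lt_of_ciInf_lt hL
  have hL' : (L : ℝ) ≠ 0 := by exact_mod_cast hL0.ne'
  set l := List.ofFn v
  have hl : l.length = L := by simp [l]
  have hPi : (List.ofFn fun l => c.E (v l)).prod = (l.map c.E).prod := by
    rw [List.map_ofFn]; rfl
  rw [hPi] at hv
  set A := (l.map c.E).prod with hA
  have hlt : specRad A < q ^ L := by
    have := Real.rpow_lt_rpow (z := L) (Real.rpow_nonneg (specRad_nonneg _) _) hv (by positivity)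
    rwa [← Real.rpow_mul (specRad_nonneg _), one_div_mul_cancel hL', Real.rpow_one,
      Real.rpow_natCast] at this
  obtain ⟨r, hr1, hr2⟩ := exists_between hlt
  have hr0 : 0 < r := (specRad_nonneg _).trans_lt hr1
  obtain ⟨C, hC, hb⟩ := exists_abs_pow_apply_le hr1
  have hlim : Tendsto (fun n : ℕ => (c.m * C) * (r / q ^ L) ^ n) atTop (nhds ((c.m * C) * 0)) :=
    (tendsto_pow_atTop_nhds_zero_of_lt_one (by positivity)
      ((div_lt_one (by positivity)).2 hr2)).const_mul _
  rw [mul_zero] at hlim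
  obtain ⟨n, hn, hn0⟩ := ((hlim.eventually (gt_mem_nhds one_pos)).and
    (eventually_gt_atTop 0)).exists
  refine ⟨L * n, by positivity, fun i => ?_⟩
  set l' := (List.replicate n l).flatten
  have hlen : l'.length = L * n := by simp [l', hl, mul_comm]
  have hprod : (l'.map c.E).prod = A ^ n := by
    simp [l', List.map_flatten, List.prod_flatten, hA]
  have h1 := hc.failProb_le_prod l' i
  rw [hlen, hprod] at h1
  refine h1.trans_lt ?_
  have h2 : (A ^ n *ᵥ 1) i ≤ c.m * C * r ^ n := by
    simp only [mulVec, dotProduct_one]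
    refine (Finset.sum_le_sum fun j _ => (le_abs_self _).trans (hb n i j)).trans ?_
    simp [mul_assoc]
  refine h2.trans_lt ?_
  rw [div_pow, ← mul_div_assoc, div_lt_one (by positivity), ← pow_mul] at hn
  exact hn

/-- A stationary selection of frequency channels whose failure matrix contracts some positive
vector at any rate above `lamInf`. -/
lemma Ergodic.exists_contracting [NeZero M] (hc : c.Ergodic) {q : ℝ} (hq : c.lamInf < q) :
    ∃ (v : Fin c.m → Fin M) (W : Fin c.m → ℝ), (∀ i, 1 ≤ W i) ∧
      ∀ i, c.failMean W i (v i) ≤ q * W i := by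
  have hq0 : 0 < q := hc.lamInf_nonneg.trans_lt hq
  obtain ⟨K, hK, hlt⟩ := hc.exists_failProb_lt hq
  -- Adding `ε` at each stage keeps the iterates strictly positive even where failure probabilities
  -- vanish; `K` such additions must still fit below `q ^ K`.
  obtain ⟨ε, hε, hεK⟩ : ∃ ε : ℝ, 0 < ε ∧ ∀ i, c.failProb K i + K * ε ≤ q ^ K := by
    have hev : ∀ i, ∀ᶠ ε in nhdsWithin (0 : ℝ) (Set.Ioi 0), c.failProb K i + K * ε < q ^ K := by
      intro i
      have : Tendsto (fun ε : ℝ => c.failProb K i + K * ε) (nhds 0)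
          (nhds (c.failProb K i + K * 0)) := by
        exact (continuous_const.add (continuous_const.mul continuous_id)).tendsto 0
      rw [mul_zero, add_zero] at this
      exact (this.mono_left nhdsWithin_le_nhds).eventually (gt_mem_nhds (hlt i))
    obtain ⟨ε, h1, h2⟩ := ((eventually_all.2 hev).and self_mem_nhdsWithin).exists
    exact ⟨ε, h2, fun i => (h1 i).le⟩
  let V : ℕ → Fin c.m → ℝ := fun k => (fun x => c.bellman x + fun _ => ε)^[k] 1
  have hV : ∀ k, V (k + 1) = c.bellman (V k) + fun _ => ε := fun k =>
    Function.iterate_succ_apply' _ _ _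
  have hVle : ∀ k, V k ≤ c.failProb k + fun _ => k * ε := by
    intro k
    induction k with
    | zero => intro i; simp [V, failProb_zero]
    | succ k ih =>
      rw [hV, failProb_succ]
      intro i
      have h1 := (hc.bellman_mono ih i).trans (hc.bellman_add_const_le _ (by positivity) i)
      simp only [Pi.add_apply] at h1 ⊢
      push_cast
      linarith
  have hVnn : ∀ k, 0 ≤ V k := by
    intro k
    induction k with
    | zero => exact zero_le_one
    | succ k ih =>
      rw [hV]
      exact add_nonneg (hc.bellman_nonneg ih) (fun _ => hε.le)
  have hVpos : ∀ k i, 0 < V k i := by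
    intro k i
    cases k with
    | zero => exact one_pos
    | succ k =>
      rw [hV]
      exact add_pos_of_nonneg_of_pos (hc.bellman_nonneg (hVnn k) i) hε
  have hVK : ∀ i, V K i ≤ q ^ K := fun i => (hVle K i).trans (hεK i)
  have : Nonempty (Fin K) := ⟨⟨0, hK⟩⟩
  -- The operator `bellman` sends `V l / q ^ l` to at most `q` times `V (l + 1) / q ^ (l + 1)`. The
  -- cycle closes because `V K / q ^ K ≤ 1 = V 0`, so the minimum over one cycle is contracted at
  -- rate `q`.
  let W : Fin c.m → ℝ := fun i => ⨅ l : Fin K, V l i / q ^ (l : ℕ)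
  have hWle : ∀ (l : Fin K) i, W i ≤ V l i / q ^ (l : ℕ) := fun l i =>
    ciInf_le (Set.finite_range _).bddBelow l
  have hWpos : ∀ i, 0 < W i := by
    intro i
    obtain ⟨l, hl⟩ := exists_eq_ciInf_of_finite (f := fun l : Fin K => V l i / q ^ (l : ℕ))
    have : W i = V l i / q ^ (l : ℕ) := hl.symm
    rw [this]
    exact div_pos (hVpos _ _) (by positivity)
  have hbW : ∀ l < K, ∀ i, c.bellman W i ≤ V (l + 1) i / q ^ l := by
    intro l hl i
    obtain ⟨v, hv⟩ := c.exists_bellman_eq (V l)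
    have h1 : c.failMean W i (v i) ≤ c.failMean ((q ^ l)⁻¹ • V l) i (v i) :=
      hc.failMean_mono (fun j => (hWle ⟨l, hl⟩ j).trans (by simp [div_eq_inv_mul])) i _
    rw [failMean_smul, ← E_mulVec _ _ (V l), hv] at h1
    refine (c.bellman_le W i (v i)).trans (h1.trans ?_)
    rw [inv_mul_eq_div, hV]
    gcongr
    simp [hε.le]
  have hstep : ∀ i, c.bellman W i ≤ q * W i := by
    intro i
    obtain ⟨⟨l, hlK⟩, hl⟩ := exists_eq_ciInf_of_finite (f := fun l : Fin K => V l i / q ^ (l : ℕ))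
    have hWi : W i = V l i / q ^ l := hl.symm
    rw [hWi]
    -- A minimum attained at `l = 0` is reached from the last index `K - 1`, any other from `l - 1`.
    cases l with
    | zero =>
      obtain ⟨k, rfl⟩ : ∃ k, K = k + 1 := ⟨K - 1, by omega⟩
      refine (hbW k (by omega) i).trans ?_
      rw [div_le_iff₀ (by positivity)]
      refine (hVK i).trans (le_of_eq ?_)
      simp [V, pow_succ']
    | succ l =>
      refine (hbW l (by omega) i).trans (le_of_eq ?_)
      field_simp
      ring
  obtain ⟨v, hv⟩ := c.exists_bellman_eq W
  obtain ⟨b, hb, hbW'⟩ := exists_pos_forall_le hWpos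
  -- Rescaling by a positive lower bound of `W` gives the normalization `1 ≤ W` and keeps the
  -- homogeneous contraction.
  refine ⟨v, b⁻¹ • W, fun i => ?_, fun i => ?_⟩
  · rw [Pi.smul_apply, smul_eq_mul, inv_mul_eq_div, one_le_div hb]
    exact hbW' i
  · rw [failMean_smul, ← E_mulVec, hv, Pi.smul_apply, smul_eq_mul, mul_left_comm]
    exact mul_le_mul_of_nonneg_left (hstep i) (by positivity)

end Channel

/-! ### Steady-state Kalman filtering and growth of the prediction error covariance. -/

section PosSemidef

open scoped MatrixOrder

lemma exists_transpose_mul_self_eq {k : ℕ} {S : Matrix (Fin k) (Fin k) ℝ} (hS : S.PosSemidef) :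
    ∃ F : Matrix (Fin k) (Fin k) ℝ, Fᵀ * F = S := by
  refine ⟨CFC.sqrt S, ?_⟩
  have h : (CFC.sqrt S)ᵀ = CFC.sqrt S := by
    have := (CFC.sqrt_nonneg S).isSelfAdjoint
    rw [IsSelfAdjoint, star_eq_conjTranspose, conjTranspose_eq_transpose_of_trivial] at this
    exact this
  rw [h, CFC.sqrt_mul_sqrt_self _ hS.nonneg]

end PosSemidef

lemma trace_conj_transpose_mul_self {k r : ℕ} (A : Matrix (Fin k) (Fin k) ℝ)
    (B : Matrix (Fin r) (Fin k) ℝ) :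
    (A * (Bᵀ * B) * Aᵀ).trace = ∑ a, ∑ b, (B * Aᵀ) b a ^ 2 := by
  have : A * (Bᵀ * B) * Aᵀ = (B * Aᵀ)ᵀ * (B * Aᵀ) := by
    simp [Matrix.mul_assoc]
  rw [this, Matrix.trace]
  simp only [diag_apply, Matrix.mul_apply (M := (B * Aᵀ)ᵀ), transpose_apply, ← sq]

namespace Plant

variable {p : Plant}

namespace KalmanSteady

lemma prior_posSemidef (hp : p.KalmanSteady) : p.prior.PosSemidef := by
  have := hp.Pbar_posSemidef.mul_mul_conjTranspose_same p.A
  exact this.add hp.W_posSemidef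

lemma prior_transpose (hp : p.KalmanSteady) : p.priorᵀ = p.prior := by
  have := hp.prior_posSemidef.isHermitian
  rwa [IsHermitian, conjTranspose_eq_transpose_of_trivial] at this

lemma innov_posSemidef (hp : p.KalmanSteady) : p.innov.PosSemidef := by
  have := hp.prior_posSemidef.mul_mul_conjTranspose_same p.C
  exact this.add hp.V_posSemidef

lemma gain_mul_innov (hp : p.KalmanSteady) : p.gain * p.innov = p.prior * p.Cᵀ := by
  rw [gain, Matrix.mul_assoc, nonsing_inv_mul _ hp.innov_isUnit, Matrix.mul_one]

/-- The Joseph form of the update of the error covariance. -/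
lemma joseph (hp : p.KalmanSteady) :
    (1 - p.gain * p.C) * p.prior * (1 - p.gain * p.C)ᵀ + p.gain * p.V * p.gainᵀ = p.Pbar := by
  -- This is what cancels the cross term when the second factor `(1 - K C)ᵀ` is expanded.
  have h1 : p.Pbar * p.Cᵀ = p.gain * p.V := by
    have h2 : p.gain * p.V = p.gain * p.innov - p.gain * (p.C * p.prior * p.Cᵀ) := by
      rw [← Matrix.mul_sub, innov, add_sub_cancel_left]
    rw [h2, hp.gain_mul_innov, ← hp.steady]
    simp only [Matrix.sub_mul, Matrix.one_mul, Matrix.mul_assoc]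
  rw [hp.steady, transpose_sub, transpose_one, transpose_mul, Matrix.mul_sub, Matrix.mul_one,
    ← Matrix.mul_assoc, h1, sub_add_cancel]

/-- A factor `B` of the decrease of the error covariance in an update, which does not vanish at
the eigenvectors of `Aᵀ` to unstable eigenvalues. -/
lemma exists_factor (hp : p.KalmanSteady) : ∃ B : Matrix (Fin p.r) (Fin p.l) ℝ,
    p.prior = p.Pbar + Bᵀ * B ∧ ∀ (z : ℂ) (u : Fin p.l → ℂ), 1 ≤ ‖z‖ → u ≠ 0 →
      (p.A.map (fun a : ℝ => (a : ℂ)))ᵀ *ᵥ u = z • u →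
      B.map (fun a : ℝ => (a : ℂ)) *ᵥ u ≠ 0 := by
  obtain ⟨F, hF⟩ := exists_transpose_mul_self_eq hp.innov_posSemidef.inv
  -- With `Fᵀ * F = innov⁻¹`, this choice makes `Bᵀ * B = K * C * prior`, the drop of the covariance
  -- in one update.
  refine ⟨F * p.C * p.prior, ?_, fun z u hz hu hzu h0 => ?_⟩
  · have h1 : (F * p.C * p.prior)ᵀ * (F * p.C * p.prior) = p.gain * p.C * p.prior := by
      rw [gain, ← hF]
      simp only [transpose_mul, hp.prior_transpose, Matrix.mul_assoc]
    rw [h1]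
    rw [← hp.steady]
    rw [Matrix.sub_mul, Matrix.one_mul, sub_add_cancel]
  · set c : ℝ →+* ℂ := Complex.ofRealHom
    -- The transposed gain factors through `B`. So if `B` kills `u`, then `u` is also an eigenvector
    -- of `((1 - K C) A)ᵀ` to the same `z`, against stability.
    have hK : p.gainᵀ = Fᵀ * (F * p.C * p.prior) := by
      have h2 : (p.innov⁻¹)ᵀ = p.innov⁻¹ := by rw [← hF]; simp
      rw [gain, transpose_mul, transpose_mul, h2, hp.prior_transpose, transpose_transpose, ← hF]
      simp only [Matrix.mul_assoc]
    have hKu : (p.gainᵀ).map c *ᵥ u = 0 := by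
      rw [hK, Matrix.map_mul, ← mulVec_mulVec]
      erw [h0]
      rw [mulVec_zero]
    have h3 : (((1 - p.gain * p.C) * p.A).map (fun a : ℝ => (a : ℂ)))ᵀ *ᵥ u = z • u := by
      rw [← hzu]
      have h4 : ((1 - p.gain * p.C) * p.A)ᵀ = p.Aᵀ - p.Aᵀ * (p.Cᵀ * p.gainᵀ) := by
        rw [Matrix.sub_mul, Matrix.one_mul, transpose_sub]
        simp only [transpose_mul, Matrix.mul_assoc]
      have h5 : (((1 - p.gain * p.C) * p.A).map c)ᵀ *ᵥ u = (p.A.map c)ᵀ *ᵥ u := by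
        rw [← transpose_map, h4, Matrix.map_sub (hf := map_sub c), sub_mulVec, Matrix.map_mul,
          Matrix.map_mul, ← mulVec_mulVec, ← mulVec_mulVec, hKu, mulVec_zero, mulVec_zero, sub_zero,
          transpose_map]
      exact h5
    have := norm_le_specRad_of_eigenvector_transpose hu h3
    linarith [hp.stable]

end KalmanSteady

/-- The error covariance of an estimate of age `j`. -/
def errCov (p : Plant) : ℕ → Matrix (Fin p.l) (Fin p.l) ℝ
  | 0 => p.Pbar
  | j + 1 => p.A * errCov p j * p.Aᵀ + p.W

/-- The first increment `prior - Pbar` is `Bᵀ * B`, and an affine recursion transports increments by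
its linear part, conjugation by `A`. This eliminates `W`. -/
lemma errCov_eq_sum {B : Matrix (Fin p.r) (Fin p.l) ℝ} (hB : p.prior = p.Pbar + Bᵀ * B) (j : ℕ) :
    p.errCov j = p.Pbar + ∑ i ∈ Finset.range j, p.A ^ i * (Bᵀ * B) * (p.A ^ i)ᵀ := by
  induction j with
  | zero => simp [errCov]
  | succ j ih =>
    rw [errCov, ih, Finset.sum_range_succ', Matrix.mul_add, Matrix.add_mul]
    have h1 : p.A * p.Pbar * p.Aᵀ = p.Pbar + Bᵀ * B - p.W := by
      rw [← hB, prior, add_sub_cancel_right]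
    rw [h1, Finset.mul_sum, Finset.sum_mul]
    have h2 : ∀ i, p.A * (p.A ^ i * (Bᵀ * B) * (p.A ^ i)ᵀ) * p.Aᵀ =
        p.A ^ (i + 1) * (Bᵀ * B) * (p.A ^ (i + 1))ᵀ := by
      intro i
      rw [pow_succ', transpose_mul]
      simp only [Matrix.mul_assoc]
    simp only [h2, pow_zero, Matrix.one_mul, transpose_one, Matrix.mul_one]
    abel

lemma KalmanSteady.exists_trace_eq (hp : p.KalmanSteady) :
    ∃ B : Matrix (Fin p.r) (Fin p.l) ℝ,
      (∀ j, (p.errCov j).trace = p.Pbar.trace +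
        ∑ i ∈ Finset.range j, ∑ a, ∑ b, (B * (p.A ^ i)ᵀ) b a ^ 2) ∧
      ∀ (z : ℂ) (u : Fin p.l → ℂ), 1 ≤ ‖z‖ → u ≠ 0 →
        (p.A.map (fun a : ℝ => (a : ℂ)))ᵀ *ᵥ u = z • u →
        B.map (fun a : ℝ => (a : ℂ)) *ᵥ u ≠ 0 := by
  obtain ⟨B, hB, hu⟩ := hp.exists_factor
  refine ⟨B, fun j => ?_, hu⟩
  rw [errCov_eq_sum hB, trace_add, trace_sum]
  simp only [trace_conj_transpose_mul_self]

/-- For an eigenvector `u` of `Aᵀ` whose eigenvalue `z` has maximal modulus, `B (A ^ i)ᵀ u = z ^ i B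
u` with `B u ≠ 0`. By Cauchy–Schwarz the squared Frobenius norm of `B (A ^ i)ᵀ` is at least
`|z|^(2i) ‖B u‖² / ‖u‖²`. -/
lemma KalmanSteady.exists_le_trace_errCov (hp : p.KalmanSteady) (hA : 1 ≤ specRad p.A) :
    ∃ c : ℝ, 0 < c ∧ ∀ j,
      c * ∑ i ∈ Finset.range j, (specRad p.A ^ 2) ^ i ≤ (p.errCov j).trace := by
  obtain ⟨B, hB, hBu⟩ := hp.exists_trace_eq
  obtain ⟨z, u, hz, hu, hzu⟩ := exists_eigenvector_transpose (one_pos.trans_le hA)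
  have hne := hBu z u (hz ▸ hA) hu hzu
  set f : ℝ →+* ℂ := Complex.ofRealHom
  set y := B.map f *ᵥ u with hy
  have hU : 0 < ∑ a, ‖u a‖ ^ 2 := by
    obtain ⟨a, ha⟩ := Function.ne_iff.1 hu
    have : 0 < ‖u a‖ := norm_pos_iff.2 ha
    exact Finset.sum_pos' (fun _ _ => by positivity) ⟨a, Finset.mem_univ _, by positivity⟩
  have hY : 0 < ∑ b, ‖y b‖ ^ 2 := by
    obtain ⟨a, ha⟩ := Function.ne_iff.1 hne
    have : 0 < ‖y a‖ := norm_pos_iff.2 ha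
    exact Finset.sum_pos' (fun _ _ => by positivity) ⟨a, Finset.mem_univ _, by positivity⟩
  refine ⟨(∑ b, ‖y b‖ ^ 2) / ∑ a, ‖u a‖ ^ 2, by positivity, fun j => ?_⟩
  have hpow : ∀ i, ((p.A ^ i)ᵀ).map f *ᵥ u = z ^ i • u := by
    intro i
    induction i with
    | zero =>
      simp only [pow_zero, transpose_one, one_smul]
      rw [Matrix.map_one _ (map_zero f) (map_one f), one_mulVec]
    | succ i ih =>
      rw [pow_succ, transpose_mul, Matrix.map_mul, ← mulVec_mulVec, ih, mulVec_smul]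
      have : (p.Aᵀ).map f *ᵥ u = z • u := hzu
      rw [this, smul_smul, pow_succ]
  rw [hB, Finset.mul_sum]
  refine le_add_of_nonneg_of_le hp.Pbar_posSemidef.trace_nonneg
    (Finset.sum_le_sum fun i _ => ?_)
  rw [div_mul_eq_mul_div, div_le_iff₀ hU, Finset.sum_comm, Finset.sum_mul, Finset.sum_mul]
  refine Finset.sum_le_sum fun b _ => ?_
  have h1 : ∑ a, ((B * (p.A ^ i)ᵀ) b a : ℂ) * u a = z ^ i * y b := by
    have h2 : (B * (p.A ^ i)ᵀ).map f *ᵥ u = z ^ i • y := by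
      rw [Matrix.map_mul, ← mulVec_mulVec, hpow, mulVec_smul]
    exact congrFun h2 b
  have h3 : ‖y b‖ * specRad p.A ^ i ≤ ∑ a, |(B * (p.A ^ i)ᵀ) b a| * ‖u a‖ := by
    rw [← hz, mul_comm, ← norm_pow, ← norm_mul, ← h1]
    refine (norm_sum_le _ _).trans (le_of_eq ?_)
    simp
  have h4 := pow_le_pow_left₀ (by have := specRad_nonneg p.A; positivity) h3 2
  have h5 := Finset.sum_mul_sq_le_sq_mul_sq Finset.univ
    (fun a => |(B * (p.A ^ i)ᵀ) b a|) (fun a => ‖u a‖)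
  simp only [sq_abs] at h5
  refine le_trans (le_of_eq ?_) (h4.trans h5)
  ring

lemma KalmanSteady.exists_trace_errCov_le (hp : p.KalmanSteady) {γ : ℝ}
    (hγ : specRad p.A ^ 2 < γ) :
    ∃ C : ℝ, 0 < C ∧ ∀ j, (p.errCov j).trace ≤ C * ∑ i ∈ Finset.range (j + 1), γ ^ i := by
  obtain ⟨B, hB, -⟩ := hp.exists_trace_eq
  have hγ0 : 0 < γ := (sq_nonneg _).trans_lt hγ
  have hs : specRad p.A < Real.sqrt γ := Real.lt_sqrt_of_sq_lt hγ
  obtain ⟨C, hC, hle⟩ := exists_abs_pow_apply_le hs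
  set D : ℝ := ∑ a : Fin p.l, ∑ b, (∑ d, |B b d| * C) ^ 2 with hD
  have hP : 0 ≤ p.Pbar.trace := hp.Pbar_posSemidef.trace_nonneg
  -- The sum over `range (j + 1)` is at least one even for `j = 0`, so it also absorbs the trace of
  -- `Pbar`.
  refine ⟨1 + p.Pbar.trace + D, by positivity, fun j => ?_⟩
  have h1 : ∀ i, ∑ a, ∑ b, (B * (p.A ^ i)ᵀ) b a ^ 2 ≤ D * γ ^ i := by
    intro i
    rw [hD, Finset.sum_mul]
    refine Finset.sum_le_sum fun a _ => ?_
    rw [Finset.sum_mul]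
    refine Finset.sum_le_sum fun b _ => ?_
    have h2 : |(B * (p.A ^ i)ᵀ) b a| ≤ (∑ d, |B b d| * C) * Real.sqrt γ ^ i := by
      rw [Matrix.mul_apply, Finset.sum_mul]
      refine (Finset.abs_sum_le_sum_abs _ _).trans (Finset.sum_le_sum fun d _ => ?_)
      rw [abs_mul, transpose_apply, mul_assoc]
      exact mul_le_mul_of_nonneg_left (hle i a d) (abs_nonneg _)
    have h3 := pow_le_pow_left₀ (abs_nonneg _) h2 2
    rw [sq_abs, mul_pow, ← pow_mul, mul_comm i 2, pow_mul, Real.sq_sqrt hγ0.le] at h3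
    exact h3
  rw [hB]
  have h4 : ∑ i ∈ Finset.range j, ∑ a, ∑ b, (B * (p.A ^ i)ᵀ) b a ^ 2 ≤
      D * ∑ i ∈ Finset.range (j + 1), γ ^ i := by
    rw [Finset.mul_sum, Finset.sum_range_succ]
    exact le_add_of_le_of_nonneg (Finset.sum_le_sum fun i _ => h1 i) (by positivity)
  have h5 : 1 ≤ ∑ i ∈ Finset.range (j + 1), γ ^ i := by
    rw [Finset.sum_range_succ']
    simp only [pow_zero]
    have : 0 ≤ ∑ i ∈ Finset.range j, γ ^ (i + 1) := by positivity
    linarith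
  nlinarith

end Plant

/-! ### Second moments of random vectors. -/

section SecondMoment

variable {Ω : Type*} {mΩ : MeasurableSpace Ω} {μ : Measure Ω}

lemma app_apply {a b : ℕ} (A : Matrix (Fin a) (Fin b) ℝ) (z : EuclideanSpace ℝ (Fin b))
    (i : Fin a) : app A z i = ∑ c, A i c * z c := rfl

lemma measurable_app {a b : ℕ} (A : Matrix (Fin a) (Fin b) ℝ) : Measurable (app A) :=
  (LinearMap.continuous_of_finiteDimensional A.toEuclideanLin).measurable

lemma app_add {a b : ℕ} (A : Matrix (Fin a) (Fin b) ℝ) (y z : EuclideanSpace ℝ (Fin b)) :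
    app A (y + z) = app A y + app A z :=
  map_add A.toEuclideanLin y z

lemma app_sub {a b : ℕ} (A : Matrix (Fin a) (Fin b) ℝ) (y z : EuclideanSpace ℝ (Fin b)) :
    app A (y - z) = app A y - app A z :=
  map_sub A.toEuclideanLin y z

lemma app_mul {a b d : ℕ} (A : Matrix (Fin a) (Fin b) ℝ) (B : Matrix (Fin b) (Fin d) ℝ)
    (z : EuclideanSpace ℝ (Fin d)) : app (A * B) z = app A (app B z) := by
  simp [app, Matrix.toLpLin_apply, mulVec_mulVec]

lemma app_one {a : ℕ} (z : EuclideanSpace ℝ (Fin a)) : app 1 z = z := by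
  simp [app]

lemma sub_app {a b : ℕ} (A B : Matrix (Fin a) (Fin b) ℝ) (z : EuclideanSpace ℝ (Fin b)) :
    app (A - B) z = app A z - app B z := by
  simp [app]

/-- The random vector `Y` is square integrable with second moments `S`. -/
structure HasSecondMoment {k : ℕ} (Y : Ω → EuclideanSpace ℝ (Fin k))
    (S : Matrix (Fin k) (Fin k) ℝ) (μ : Measure Ω) : Prop where
  memLp : MemLp Y 2 μ
  integral_eq : ∀ i j, ∫ ω, Y ω i * Y ω j ∂μ = S i j

namespace HasSecondMoment

variable {k : ℕ} {Y Z : Ω → EuclideanSpace ℝ (Fin k)} {S T : Matrix (Fin k) (Fin k) ℝ}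

lemma integrable_mul (h : HasSecondMoment Y S μ) (i j : Fin k) :
    Integrable (fun ω => Y ω i * Y ω j) μ :=
  (h.memLp.eval_piLp i).integrable_mul (h.memLp.eval_piLp j)

lemma app {a : ℕ} (A : Matrix (Fin a) (Fin k) ℝ) (h : HasSecondMoment Y S μ) :
    HasSecondMoment (fun ω => RemoteEst.app A (Y ω)) (A * S * Aᵀ) μ where
  memLp := (LinearMap.toContinuousLinearMap A.toEuclideanLin).comp_memLp' h.memLp
  integral_eq i j := by
    have hint : ∀ c d, Integrable (fun ω => A i c * Y ω c * (A j d * Y ω d)) μ := fun c d =>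
      ((h.integrable_mul c d).const_mul (A i c * A j d)).congr
        (Eventually.of_forall fun ω => by ring)
    simp only [app_apply, Finset.sum_mul_sum]
    rw [integral_finsetSum _ fun c _ => integrable_finsetSum _ fun d _ => hint c d]
    simp only [Matrix.mul_apply, transpose_apply, Finset.sum_mul]
    rw [Finset.sum_comm]
    refine Finset.sum_congr rfl fun d _ => ?_
    rw [integral_finsetSum _ fun c _ => hint d c]
    refine Finset.sum_congr rfl fun c _ => ?_
    have : ∀ ω, A i d * Y ω d * (A j c * Y ω c) = A i d * A j c * (Y ω d * Y ω c) :=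
      fun ω => by ring
    simp only [this]
    rw [integral_const_mul, h.integral_eq]
    ring

lemma neg (h : HasSecondMoment Y S μ) : HasSecondMoment (fun ω => -Y ω) S μ where
  memLp := h.memLp.neg
  integral_eq i j := by simpa using h.integral_eq i j

/-- It is enough that `Z` is centred; the initial estimation error, which enters through `Y`, may
have a nonzero mean. -/
lemma add [IsProbabilityMeasure μ] (h : HasSecondMoment Y S μ) (h' : HasSecondMoment Z T μ)
    (hind : IndepFun Y Z μ) (hZ : ∀ i, ∫ ω, Z ω i ∂μ = 0) :
    HasSecondMoment (fun ω => Y ω + Z ω) (S + T) μ where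
  memLp := h.memLp.add h'.memLp
  integral_eq i j := by
    have hcross : ∀ i j, Integrable (fun ω => Y ω i * Z ω j) μ := fun i j =>
      (h.memLp.eval_piLp i).integrable_mul (h'.memLp.eval_piLp j)
    have hzero : ∀ i j, ∫ ω, Y ω i * Z ω j ∂μ = 0 := by
      intro i j
      rw [hind.integral_fun_comp_mul_comp (f := fun y => y i) (g := fun z => z j)
        h.memLp.1.aemeasurable h'.memLp.1.aemeasurable
        (by fun_prop) (by fun_prop), hZ, mul_zero]
    have hexp : ∀ ω, (Y ω + Z ω) i * (Y ω + Z ω) j =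
        Y ω i * Y ω j + Y ω i * Z ω j + Y ω j * Z ω i + Z ω i * Z ω j := fun ω => by
      simp only [PiLp.add_apply]; ring
    simp only [hexp]
    have h1 : Integrable (fun ω => Y ω i * Y ω j + Y ω i * Z ω j) μ :=
      (h.integrable_mul i j).add (hcross i j)
    have h2 : Integrable (fun ω => Y ω i * Y ω j + Y ω i * Z ω j + Y ω j * Z ω i) μ :=
      h1.add (hcross j i)
    rw [integral_add h2 (h'.integrable_mul i j), integral_add h1 (hcross j i),
      integral_add (h.integrable_mul i j) (hcross i j), hzero, hzero, h.integral_eq, h'.integral_eq,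
      add_zero, add_zero, Matrix.add_apply]

lemma lintegral_enorm_sq (h : HasSecondMoment Y S μ) :
    ∫⁻ ω, ‖Y ω‖ₑ ^ 2 ∂μ = ENNReal.ofReal S.trace := by
  have h1 : ∀ ω, ‖Y ω‖ₑ ^ 2 = ENNReal.ofReal (∑ i, Y ω i * Y ω i) := fun ω => by
    rw [← ofReal_norm, ← ENNReal.ofReal_pow (norm_nonneg _), EuclideanSpace.norm_sq_eq]
    simp [sq]
  simp only [h1]
  rw [← ofReal_integral_eq_lintegral_ofReal
    (integrable_finsetSum _ fun i _ => h.integrable_mul i i)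
    (Eventually.of_forall fun ω => Finset.sum_nonneg fun i _ => mul_self_nonneg _),
    integral_finsetSum _ fun i _ => h.integrable_mul i i]
  simp [h.integral_eq, Matrix.trace]

end HasSecondMoment

lemma hasSecondMoment_of_map_eq_gaussian {k : ℕ} {Y : Ω → EuclideanSpace ℝ (Fin k)}
    {S : Matrix (Fin k) (Fin k) ℝ} (hS : S.PosSemidef) (hY : Measurable Y)
    (h : μ.map Y = multivariateGaussian 0 S) :
    HasSecondMoment Y S μ ∧ ∀ i, ∫ ω, Y ω i ∂μ = 0 := by
  have hLp : MemLp (fun y : EuclideanSpace ℝ (Fin k) => y) 2 (multivariateGaussian 0 S) :=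
    IsGaussian.memLp_two_id
  have hmean : ∀ i, ∫ y, y i ∂(multivariateGaussian (0 : EuclideanSpace ℝ (Fin k)) S) = 0 := by
    intro i
    have := (EuclideanSpace.proj (𝕜 := ℝ) i).integral_comp_id_comm
      (μ := multivariateGaussian (0 : EuclideanSpace ℝ (Fin k)) S)
      (IsGaussian.integrable_id)
    simpa using this
  refine ⟨⟨?_, fun i j => ?_⟩, fun i => ?_⟩
  · rw [← h] at hLp
    exact hLp.comp_of_map hY.aemeasurable
  · have h1 := covariance_eval_multivariateGaussian (μ := 0) hS i j
    rw [covariance_eq_sub (hLp.eval_piLp i) (hLp.eval_piLp j), hmean, zero_mul, sub_zero, ← h,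
      integral_map hY.aemeasurable (by fun_prop)] at h1
    exact h1
  · have h1 := hmean i
    rw [← h, integral_map hY.aemeasurable (by fun_prop)] at h1
    exact h1

end SecondMoment

/-! ### Estimation errors as functions of the noises. -/

/-- The joint states of the channels. -/
abbrev Setup.State {N M : ℕ} (S : Setup N M) : Type := (n : Fin N) → Fin (S.chan n).m

/-- The sources of randomness of the process `n` that precede the process noise of the slot `t` and
the measurement noise of the slot `u + 1`. -/
def pastSources {N : ℕ} (n : Fin N) (t u : ℕ) : Set (Source N) :=
  {.init n} ∪ {a | ∃ s < t, a = .procNoise n s} ∪ {a | ∃ s ≤ u, a = .measNoise n s}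

/-- The set of the channels as sources of randomness. -/
def channelSources (N : ℕ) : Set (Source N) := Set.range Source.channel

lemma pastSources_mono {N : ℕ} (n : Fin N) {t t' u u' : ℕ} (ht : t ≤ t') (hu : u ≤ u') :
    pastSources n t u ⊆ pastSources n t' u' := by
  rintro a ((h | ⟨s, hs, rfl⟩) | ⟨s, hs, rfl⟩)
  · exact Or.inl (Or.inl h)
  · exact Or.inl (Or.inr ⟨s, hs.trans_le ht, rfl⟩)
  · exact Or.inr ⟨s, hs.trans hu, rfl⟩

namespace Policy

variable {N M : ℕ} {S : Setup N M}

/-- Whether the packet of the sensor `n` is received when the ages of information are `φ` and the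
channel states change from `h` to `h'`. -/
def recv (π : Policy S) (φ : Fin N → ℕ) (h h' : S.State) (n : Fin N) : Bool :=
  match π.sel φ h n with
  | none => false
  | some m => (S.chan n).h (h' n) m

/-- The update of the ages of information. -/
def step (π : Policy S) (φ : Fin N → ℕ) (h h' : S.State) (n : Fin N) : ℕ :=
  if π.recv φ h h' n = true then 1 else φ n + 1

end Policy

namespace Vars

variable {N M : ℕ} {S : Setup N M} {Ω : Type*} (X : Vars S Ω) (π : Policy S)

/-- The σ-algebra generated by a set of sources of randomness. -/
@[reducible] def sigmaOn (T : Set (Source N)) : MeasurableSpace Ω := ⨆ a ∈ T, X.sigma a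

lemma sigma_le_sigmaOn {T : Set (Source N)} {a : Source N} (ha : a ∈ T) :
    X.sigma a ≤ X.sigmaOn T :=
  le_iSup₂ (f := fun a (_ : a ∈ T) => X.sigma a) a ha

lemma sigmaOn_mono {T T' : Set (Source N)} (h : T ⊆ T') : X.sigmaOn T ≤ X.sigmaOn T' :=
  biSup_mono h

lemma measurable_w_sigmaOn (n : Fin N) (t : ℕ) :
    Measurable[X.sigmaOn {.procNoise n t}] (X.w n t) :=
  (comap_measurable (X.w n t)).mono (X.sigma_le_sigmaOn (a := .procNoise n t) rfl) le_rfl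

lemma measurable_v_sigmaOn (n : Fin N) (t : ℕ) :
    Measurable[X.sigmaOn {.measNoise n t}] (X.v n t) :=
  (comap_measurable (X.v n t)).mono (X.sigma_le_sigmaOn (a := .measNoise n t) rfl) le_rfl

/-- The joint channel state in the slot `t`. -/
def chanState (t : ℕ) (ω : Ω) : S.State := fun n => X.ch n t ω

lemma aoi_succ (ω : Ω) (k : ℕ) : X.aoi π ω (k + 1) =
    π.step (X.aoi π ω k) (X.chanState (S.start + k) ω) (X.chanState (S.start + k + 1) ω) := rfl

lemma one_le_aoi (ω : Ω) (k : ℕ) (n : Fin N) : 1 ≤ X.aoi π ω k n := by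
  cases k with
  | zero => have := S.last_le n; simp only [aoi]; omega
  | succ k => rw [aoi_succ, Policy.step]; split_ifs <;> omega

/-- The error of the estimate of age `j` based on the packet sent in the slot `s`. -/
noncomputable def packetErr (n : Fin N) (s : ℕ) : ℕ → Ω → EuclideanSpace ℝ (Fin (S.plant n).l)
  | 0 => fun ω => X.xs n s ω - X.x n s ω
  | j + 1 => fun ω => app (S.plant n).A (packetErr n s j ω) - X.w n (s + j) ω

lemma packetErr_succ (n : Fin N) (s j : ℕ) (ω : Ω) : X.packetErr n s (j + 1) ω =
    app (S.plant n).A (X.packetErr n s j ω) - X.w n (s + j) ω := rfl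

variable {X}

variable [mΩ : MeasurableSpace Ω] {μ : Measure Ω}

namespace IsModel

lemma sigma_le (hX : X.IsModel μ) (a : Source N) : X.sigma a ≤ mΩ := by
  cases a with
  | init n => exact sup_le (hX.measurable_x_zero n).comap_le (hX.measurable_xs_zero n).comap_le
  | procNoise n t => exact (hX.measurable_w n t).comap_le
  | measNoise n t => exact (hX.measurable_v n t).comap_le
  | channel n => exact iSup_le fun t => (hX.measurable_ch n t).comap_le

lemma sigmaOn_le (hX : X.IsModel μ) (T : Set (Source N)) : X.sigmaOn T ≤ mΩ :=
  iSup₂_le fun a _ => hX.sigma_le a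

lemma indep_sigmaOn (hX : X.IsModel μ) {T T' : Set (Source N)} (h : Disjoint T T') :
    Indep (X.sigmaOn T) (X.sigmaOn T') μ :=
  indep_iSup_of_disjoint hX.sigma_le hX.indep h

lemma indepFun_of_measurable (hX : X.IsModel μ) {β γ : Type*} [MeasurableSpace β]
    [MeasurableSpace γ] {T T' : Set (Source N)} (h : Disjoint T T') {f : Ω → β} {g : Ω → γ}
    (hf : Measurable[X.sigmaOn T] f) (hg : Measurable[X.sigmaOn T'] g) : IndepFun f g μ :=
  indep_of_indep_of_le_left (indep_of_indep_of_le_right (hX.indep_sigmaOn h) hg.comap_le)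
    hf.comap_le

/-- The form separates the fresh noises from the past error, so that second moments add up to the
expression in `joseph`. -/
lemma packetErr_zero_succ (hX : X.IsModel μ) (n : Fin N) (s : ℕ) (ω : Ω) :
    X.packetErr n (s + 1) 0 ω =
      app (1 - (S.plant n).gain * (S.plant n).C)
        (app (S.plant n).A (X.packetErr n s 0 ω) + -X.w n s ω) +
      app (S.plant n).gain (X.v n (s + 1) ω) := by
  simp only [packetErr, hX.kalman, hX.dynamics, y, sub_app, app_one, app_mul, app_sub, app_add,
    ← sub_eq_add_neg]
  abel

lemma measurable_packetErr_zero (hX : X.IsModel μ) (n : Fin N) (s : ℕ) :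
    Measurable[X.sigmaOn (pastSources n s s)] (X.packetErr n s 0) := by
  induction s with
  | zero =>
    have h0 : X.sigma (.init n) ≤ X.sigmaOn (pastSources n 0 0) :=
      X.sigma_le_sigmaOn (Or.inl (Or.inl rfl))
    exact ((comap_measurable (X.xs n 0)).mono (le_sup_right.trans h0) le_rfl).sub
      ((comap_measurable (X.x n 0)).mono (le_sup_left.trans h0) le_rfl)
  | succ s ih =>
    have h1 : Measurable[X.sigmaOn (pastSources n (s + 1) (s + 1))] (X.packetErr n s 0) :=
      ih.mono (X.sigmaOn_mono (pastSources_mono n (by omega) (by omega))) le_rfl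
    have h2 : Measurable[X.sigmaOn (pastSources n (s + 1) (s + 1))] (X.w n s) :=
      (X.measurable_w_sigmaOn n s).mono (X.sigmaOn_mono (Set.singleton_subset_iff.2
        (Or.inl (Or.inr ⟨s, by omega, rfl⟩)))) le_rfl
    have h3 : Measurable[X.sigmaOn (pastSources n (s + 1) (s + 1))] (X.v n (s + 1)) :=
      (X.measurable_v_sigmaOn n (s + 1)).mono (X.sigmaOn_mono (Set.singleton_subset_iff.2
        (Or.inr ⟨s + 1, by omega, rfl⟩))) le_rfl
    have h4 : X.packetErr n (s + 1) 0 = fun ω => _ := funext (hX.packetErr_zero_succ n s)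
    rw [h4]
    exact ((measurable_app _).comp (((measurable_app _).comp h1).add h2.neg)).add
      ((measurable_app _).comp h3)

lemma measurable_packetErr (hX : X.IsModel μ) (n : Fin N) (s j : ℕ) :
    Measurable[X.sigmaOn (pastSources n (s + j) s)] (X.packetErr n s j) := by
  induction j with
  | zero => exact hX.measurable_packetErr_zero n s
  | succ j ih =>
    have h1 : Measurable[X.sigmaOn (pastSources n (s + (j + 1)) s)] (X.packetErr n s j) :=
      ih.mono (X.sigmaOn_mono (pastSources_mono n (by omega) le_rfl)) le_rfl
    have h2 : Measurable[X.sigmaOn (pastSources n (s + (j + 1)) s)] (X.w n (s + j)) :=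
      (X.measurable_w_sigmaOn n (s + j)).mono (X.sigmaOn_mono (Set.singleton_subset_iff.2
        (Or.inl (Or.inr ⟨s + j, by omega, rfl⟩)))) le_rfl
    exact ((measurable_app _).comp h1).sub h2

lemma hasSecondMoment_w (hX : X.IsModel μ) (n : Fin N) (t : ℕ) :
    HasSecondMoment (X.w n t) (S.plant n).W μ ∧ ∀ i, ∫ ω, X.w n t ω i ∂μ = 0 :=
  hasSecondMoment_of_map_eq_gaussian (S.plant_steady n).W_posSemidef (hX.measurable_w n t)
    (hX.law_w n t)

lemma hasSecondMoment_v (hX : X.IsModel μ) (n : Fin N) (t : ℕ) :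
    HasSecondMoment (X.v n t) (S.plant n).V μ ∧ ∀ i, ∫ ω, X.v n t ω i ∂μ = 0 :=
  hasSecondMoment_of_map_eq_gaussian (S.plant_steady n).V_posSemidef (hX.measurable_v n t)
    (hX.law_v n t)

lemma app_pow_sub (hX : X.IsModel μ) (n : Fin N) (s j : ℕ) (ω : Ω) :
    app ((S.plant n).A ^ j) (X.xs n s ω) - X.x n (s + j) ω = X.packetErr n s j ω := by
  induction j with
  | zero => simp [packetErr, app_one]
  | succ j ih =>
    rw [packetErr_succ, ← ih, pow_succ', app_mul, ← add_assoc, hX.dynamics, app_sub]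
    abel

/-- Here `s` is the slot in which the latest received packet was sent. It depends on `ω`. -/
lemma exists_xhat_sub_eq (hX : X.IsModel μ) (n : Fin N) (ω : Ω) (k : ℕ) :
    ∃ s, s + X.aoi π ω k n = S.start + 1 + k ∧
      X.xhat π n ω k - X.x n (S.start + 1 + k) ω = X.packetErr n s (X.aoi π ω k n) ω := by
  induction k with
  | zero =>
    have := S.last_le n
    have h1 : S.last n + (S.start + 1 - S.last n) = S.start + 1 + 0 := by omega
    refine ⟨S.last n, h1, ?_⟩
    have := hX.app_pow_sub n (S.last n) (S.start + 1 - S.last n) ω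
    rw [h1] at this
    exact this
  | succ k ih =>
    obtain ⟨s, hs, h⟩ := ih
    simp only [xhat, aoi]
    split_ifs with hr
    · refine ⟨S.start + 1 + k, by omega, ?_⟩
      have := hX.app_pow_sub n (S.start + 1 + k) 1 ω
      rw [pow_one] at this
      exact this
    · refine ⟨s, by omega, ?_⟩
      rw [packetErr_succ, ← h, ← add_assoc, hX.dynamics, app_sub, hs]
      abel

variable [IsProbabilityMeasure μ]

lemma integral_app_eq_zero {a b : ℕ} (A : Matrix (Fin a) (Fin b) ℝ)
    {Y : Ω → EuclideanSpace ℝ (Fin b)} (hY : MemLp Y 2 μ) (h : ∀ i, ∫ ω, Y ω i ∂μ = 0)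
    (i : Fin a) : ∫ ω, (app A (Y ω)) i ∂μ = 0 := by
  have hint : ∀ c, Integrable (fun ω => Y ω c) μ := fun c =>
    (hY.eval_piLp c).integrable (by norm_num)
  simp only [app_apply]
  rw [integral_finsetSum _ fun c _ => (hint c).const_mul _]
  simp [integral_const_mul, h]

lemma disjoint_pastSources_procNoise (n : Fin N) (t u : ℕ) :
    Disjoint (pastSources n t u) {Source.procNoise n t} := by
  rw [Set.disjoint_singleton_right]
  rintro ((h | ⟨s, hs, h⟩) | ⟨s, hs, h⟩)
  · simp at h
  · simp only [Source.procNoise.injEq, true_and] at h; omega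
  · simp at h

lemma hasSecondMoment_step (hX : X.IsModel μ) {n : Fin N} {t u : ℕ}
    {Y : Ω → EuclideanSpace ℝ (Fin (S.plant n).l)}
    {Q : Matrix (Fin (S.plant n).l) (Fin (S.plant n).l) ℝ}
    (hY : Measurable[X.sigmaOn (pastSources n t u)] Y) (hQ : HasSecondMoment Y Q μ) :
    HasSecondMoment (fun ω => app (S.plant n).A (Y ω) + -X.w n t ω)
      ((S.plant n).A * Q * (S.plant n).Aᵀ + (S.plant n).W) μ := by
  refine (hQ.app _).add (hX.hasSecondMoment_w n t).1.neg ?_ fun i => ?_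
  · exact hX.indepFun_of_measurable (disjoint_pastSources_procNoise n t u)
      ((measurable_app _).comp hY) (X.measurable_w_sigmaOn n t).neg
  · simp only [PiLp.neg_apply]
    rw [integral_neg, (hX.hasSecondMoment_w n t).2, neg_zero]

lemma hasSecondMoment_packetErr_zero (hX : X.IsModel μ) (n : Fin N) (s : ℕ) :
    HasSecondMoment (X.packetErr n s 0) (S.plant n).Pbar μ := by
  induction s with
  | zero => exact ⟨hX.init_memLp n, hX.init_cov n⟩
  | succ s ih =>
    have h4 : X.packetErr n (s + 1) 0 = fun ω => _ := funext (hX.packetErr_zero_succ n s)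
    rw [h4, ← (S.plant_steady n).joseph]
    have h1 := hX.measurable_packetErr_zero n s
    refine ((hX.hasSecondMoment_step h1 ih).app _).add ((hX.hasSecondMoment_v n (s + 1)).1.app _)
      ?_ (integral_app_eq_zero _ (hX.hasSecondMoment_v n _).1.memLp
        (hX.hasSecondMoment_v n _).2)
    have hd : Disjoint (pastSources n (s + 1) s) {Source.measNoise n (s + 1)} := by
      rw [Set.disjoint_singleton_right]
      rintro ((h | ⟨s, hs, h⟩) | ⟨s, hs, h⟩)
      · simp at h
      · simp at h
      · simp only [Source.measNoise.injEq, true_and] at h; omega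
    refine hX.indepFun_of_measurable hd ((measurable_app _).comp (((measurable_app _).comp
      (h1.mono (X.sigmaOn_mono (pastSources_mono n (by omega) le_rfl)) le_rfl)).add
      ((X.measurable_w_sigmaOn n s).mono (X.sigmaOn_mono (Set.singleton_subset_iff.2
        (Or.inl (Or.inr ⟨s, by omega, rfl⟩)))) le_rfl).neg))
      ((measurable_app _).comp (X.measurable_v_sigmaOn n (s + 1)))

lemma hasSecondMoment_packetErr (hX : X.IsModel μ) (n : Fin N) (s j : ℕ) :
    HasSecondMoment (X.packetErr n s j) ((S.plant n).errCov j) μ := by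
  induction j with
  | zero => exact hX.hasSecondMoment_packetErr_zero n s
  | succ j ih =>
    have h1 := hX.hasSecondMoment_step (hX.measurable_packetErr n s j) ih
    simp only [← sub_eq_add_neg] at h1
    exact h1

end IsModel

end Vars

/-! ### The joint channel chain and the mean-square error in terms of ages. -/

namespace Setup

variable {N M : ℕ} {S : Setup N M}

/-- The transition probabilities of the joint channel state. -/
noncomputable def trans (S : Setup N M) (h h' : S.State) : ℝ := ∏ n, (S.chan n).P (h n) (h' n)

lemma trans_nonneg (h h' : S.State) : 0 ≤ S.trans h h' :=
  Finset.prod_nonneg fun n _ => (S.chan_ergodic n).P_nonneg _ _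

/-- The factors of the other chains sum to one. This reduces the joint chain to the chain of a
single sensor. -/
lemma sum_trans_mul (n : Fin N) (y : Fin (S.chan n).m → ℝ) (h : S.State) :
    ∑ h', S.trans h h' * y (h' n) = ∑ j, (S.chan n).P (h n) j * y j := by
  classical
  let f : (m : Fin N) → Fin (S.chan m).m → ℝ := Function.update (fun m _ => 1) n y
  have hf : ∀ m, m ≠ n → f m = fun _ => 1 := fun m hm => Function.update_of_ne hm _ _
  have hfn : f n = y := Function.update_self _ _ _
  have h1 := Finset.prod_univ_sum (fun m : Fin N => (Finset.univ : Finset (Fin (S.chan m).m)))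
    (fun m j => (S.chan m).P (h m) j * f m j)
  rw [Fintype.piFinset_univ, Finset.prod_eq_single n] at h1
  · rw [← hfn, h1]
    refine Finset.sum_congr rfl fun h' _ => ?_
    rw [Finset.prod_mul_distrib, Finset.prod_eq_single n (f := fun m => f m (h' m))]
    · rfl
    · intro m _ hm
      rw [hf m hm]
    · simp
  · intro m _ hm
    simp [hf m hm, (S.chan_ergodic m).sum_P]
  · simp

lemma sum_trans_le_one (h : S.State) : ∑ h', S.trans h h' ≤ 1 := by
  classical
  have h1 := Finset.prod_univ_sum (fun m : Fin N => (Finset.univ : Finset (Fin (S.chan m).m)))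
    (fun m j => (S.chan m).P (h m) j)
  rw [Fintype.piFinset_univ] at h1
  simp only [(S.chan_ergodic _).sum_P, Finset.prod_const_one] at h1
  exact h1.symm.le

end Setup

namespace Policy

variable {N M : ℕ} {S : Setup N M}

/-- One step of the joint Markov chain of the ages of information and the channel states, as an
operator on functions. -/
noncomputable def next (π : Policy S) (f : (Fin N → ℕ) → S.State → ℝ)
    (φ : Fin N → ℕ) (h : S.State) : ℝ :=
  ∑ h', S.trans h h' * f (π.step φ h h') h'

end Policy

namespace Vars

variable {N M : ℕ} {S : Setup N M} {Ω : Type*} (X : Vars S Ω) (π : Policy S)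

/-- The joint channel states up to the slot `t`. -/
def hist (t : ℕ) (ω : Ω) : Fin (t + 1) → S.State := fun k => X.chanState k ω

/-- The ages are a function of finitely many finite-valued channel states, so their measurability is
automatic and the Markov property can be applied to histories. -/
lemma exists_aoi_eq (k : ℕ) : ∃ F : (Fin (S.start + k + 1) → S.State) → Fin N → ℕ,
    ∀ ω, X.aoi π ω k = F (X.hist (S.start + k) ω) := by
  induction k with
  | zero => exact ⟨fun _ n => S.start + 1 - S.last n, fun _ => rfl⟩
  | succ k ih =>
    obtain ⟨F, hF⟩ := ih
    refine ⟨fun g => π.step (F fun i => g i.castSucc) (g (Fin.last _).castSucc) (g (Fin.last _)),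
      fun ω => ?_⟩
    rw [aoi_succ, hF]
    rfl

lemma measurable_hist (t : ℕ) : Measurable[X.sigmaOn (channelSources N)] (X.hist t) := by
  let _ : MeasurableSpace Ω := X.sigmaOn (channelSources N)
  refine measurable_pi_lambda _ fun k => measurable_pi_lambda _ fun n => ?_
  refine (comap_measurable (X.ch n k)).mono (le_trans ?_ (X.sigma_le_sigmaOn
    (a := .channel n) ⟨n, rfl⟩)) le_rfl
  exact le_iSup (fun t => MeasurableSpace.comap (X.ch n t) inferInstance) (k : ℕ)

lemma measurable_aoi (k : ℕ) :
    Measurable[X.sigmaOn (channelSources N)] (fun ω => X.aoi π ω k) := by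
  obtain ⟨F, hF⟩ := X.exists_aoi_eq π k
  have hF' : (fun ω => X.aoi π ω k) = F ∘ X.hist (S.start + k) := funext hF
  have hFm : Measurable F := Measurable.of_discrete
  rw [hF']
  exact @Measurable.comp _ _ _ (X.sigmaOn (channelSources N)) _ _ F _ hFm (X.measurable_hist _)

variable {X}

variable [mΩ : MeasurableSpace Ω] {μ : Measure Ω}

namespace IsModel

lemma measure_hist_succ (hX : X.IsModel μ) (t : ℕ) (g : Fin (t + 1) → S.State) (b : S.State) :
    μ {ω | X.hist (t + 1) ω = Fin.snoc (α := fun _ => S.State) g b} =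
      μ {ω | X.hist t ω = g} * ENNReal.ofReal (S.trans (g (Fin.last t)) b) := by
  have hind : iIndep (fun n => X.sigma (.channel n)) μ :=
    hX.indep.precomp (g := Source.channel) (fun _ _ h => by simpa using h)
  -- The history is extended to all of `ℕ`, as the Markov property of each chain is stated for
  -- sequences; only the values up to `t + 1` matter.
  let s : ℕ → S.State := fun k => if h : k < t + 1 then g ⟨k, h⟩ else b
  have hprod : ∀ u, μ {ω | ∀ k ≤ u, X.chanState k ω = s k} =
      ∏ n, μ {ω | ∀ k ≤ u, X.ch n k ω = s k n} := by
    intro u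
    rw [← hind.meas_iInter (s := fun n => {ω | ∀ k ≤ u, X.ch n k ω = s k n})]
    · congr 1
      ext ω
      simp only [chanState, funext_iff, Set.mem_ofPred_eq, Set.mem_iInter]
      exact ⟨fun h n k hk => h k hk n, fun h k hk n => h n k hk⟩
    · intro n
      have : {ω | ∀ k ≤ u, X.ch n k ω = s k n} = ⋂ k ∈ Set.Iic u, X.ch n k ⁻¹' {s k n} := by
        ext ω; simp
      rw [this]
      refine MeasurableSet.biInter (Set.to_countable _) fun k _ => ?_
      exact (le_iSup (fun t => MeasurableSpace.comap (X.ch n t) inferInstance) k) _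
        ⟨_, MeasurableSet.singleton _, rfl⟩
  have hs1 : ∀ k : Fin (t + 1), s k = g k := fun k => dif_pos k.2
  have hs2 : s (t + 1) = b := by simp [s]
  have e1 : {ω | X.hist (t + 1) ω = Fin.snoc (α := fun _ => S.State) g b} =
      {ω | ∀ k ≤ t + 1, X.chanState k ω = s k} := by
    ext ω
    simp only [Set.mem_ofPred_eq]
    constructor
    · intro h k hk
      rcases Nat.lt_or_ge k (t + 1) with hk' | hk'
      · have := congrFun h (Fin.castSucc ⟨k, hk'⟩)
        rw [Fin.snoc_castSucc] at this
        rw [← hs1] at this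
        exact this
      · obtain rfl : k = t + 1 := by omega
        have := congrFun h (Fin.last _)
        rw [Fin.snoc_last] at this
        rw [hs2]
        exact this
    · intro h
      funext k
      refine Fin.lastCases ?_ (fun k => ?_) k
      · rw [Fin.snoc_last, ← hs2]
        exact h _ le_rfl
      · rw [Fin.snoc_castSucc, ← hs1]
        exact h _ (by omega)
  have e2 : {ω | X.hist t ω = g} = {ω | ∀ k ≤ t, X.chanState k ω = s k} := by
    ext ω
    simp only [Set.mem_ofPred_eq, funext_iff (f := X.hist t ω)]
    constructor
    · intro h k hk
      have := h ⟨k, by omega⟩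
      rw [← hs1] at this
      exact this
    · intro h k
      rw [← hs1]
      exact h k (by omega)
  rw [e1, e2, hprod, hprod]
  have h3 : S.trans (g (Fin.last t)) b = ∏ n, (S.chan n).P (s t n) (s (t + 1) n) := by
    rw [hs2, ← hs1]
    rfl
  rw [h3, ENNReal.ofReal_prod_of_nonneg fun n _ => (S.chan_ergodic n).P_nonneg _ _,
    ← Finset.prod_mul_distrib]
  exact Finset.prod_congr rfl fun n _ => hX.markov n t fun k => s k n

lemma measurable_hist (hX : X.IsModel μ) (t : ℕ) : Measurable (X.hist t) :=
  (X.measurable_hist t).mono (hX.sigmaOn_le _) le_rfl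

lemma lintegral_hist (hX : X.IsModel μ) (t : ℕ) (f : (Fin (t + 1) → S.State) → ℝ≥0∞) :
    ∫⁻ ω, f (X.hist t ω) ∂μ = ∑ g, f g * μ {ω | X.hist t ω = g} := by
  rw [← lintegral_map (f := f) (Measurable.of_discrete) (hX.measurable_hist t), lintegral_fintype]
  refine Finset.sum_congr rfl fun g _ => ?_
  rw [Measure.map_apply (hX.measurable_hist t) (MeasurableSet.singleton g)]
  rfl

/-- The Markov property of the joint channel state. -/
lemma lintegral_hist_succ (hX : X.IsModel μ) (t : ℕ)
    (f : (Fin (t + 1) → S.State) → S.State → ℝ≥0∞) :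
    ∫⁻ ω, f (X.hist t ω) (X.chanState (t + 1) ω) ∂μ =
      ∫⁻ ω, ∑ b, ENNReal.ofReal (S.trans (X.chanState t ω) b) * f (X.hist t ω) b ∂μ := by
  have h1 := hX.lintegral_hist (t + 1) (fun g => f (fun k => g k.castSucc) (g (Fin.last _)))
  have h2 := hX.lintegral_hist t
    (fun g => ∑ b, ENNReal.ofReal (S.trans (g (Fin.last t)) b) * f g b)
  refine h1.trans (Eq.trans ?_ h2.symm)
  rw [← (Fin.snocEquiv fun _ : Fin (t + 2) => S.State).sum_comp, Fintype.sum_prod_type,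
    Finset.sum_comm]
  refine Finset.sum_congr rfl fun g _ => ?_
  rw [Finset.sum_mul]
  refine Finset.sum_congr rfl fun b _ => ?_
  have h3 := hX.measure_hist_succ t g b
  simp only [Fin.snocEquiv, Equiv.coe_fn_mk, Fin.snoc_castSucc, Fin.snoc_last]
  erw [h3]
  ring

lemma lintegral_next (hX : X.IsModel μ) {f : (Fin N → ℕ) → S.State → ℝ} (hf : ∀ φ h, 0 ≤ f φ h)
    (k : ℕ) :
    ∫⁻ ω, ENNReal.ofReal (f (X.aoi π ω (k + 1)) (X.chanState (S.start + k + 1) ω)) ∂μ =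
      ∫⁻ ω, ENNReal.ofReal (π.next f (X.aoi π ω k) (X.chanState (S.start + k) ω)) ∂μ := by
  obtain ⟨F, hF⟩ := X.exists_aoi_eq π k
  have h1 := hX.lintegral_hist_succ (S.start + k)
    (fun g b => ENNReal.ofReal (f (π.step (F g) (g (Fin.last _)) b) b))
  simp only [← hF] at h1
  refine h1.trans ?_
  congr 1
  funext ω
  rw [Policy.next, ENNReal.ofReal_sum_of_nonneg
    (fun b _ => mul_nonneg (Setup.trans_nonneg _ _) (hf _ _))]
  refine Finset.sum_congr rfl fun b _ => ?_
  rw [ENNReal.ofReal_mul (Setup.trans_nonneg _ _)]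
  rfl

lemma lintegral_ch_add (hX : X.IsModel μ) (n : Fin N) {y : Fin (S.chan n).m → ℝ} (hy : 0 ≤ y)
    (t s : ℕ) : ∫⁻ ω, ENNReal.ofReal (y (X.ch n (t + s) ω)) ∂μ =
      ∫⁻ ω, ENNReal.ofReal (((S.chan n).P ^ s *ᵥ y) (X.ch n t ω)) ∂μ := by
  induction s generalizing y with
  | zero => simp
  | succ s ih =>
    have h1 := hX.lintegral_hist_succ (t + s) (fun _ b => ENNReal.ofReal (y (b n)))
    refine h1.trans ?_
    rw [pow_succ, ← mulVec_mulVec, ← ih (y := (S.chan n).P *ᵥ y)]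
    · congr 1
      funext ω
      have h2 : ((S.chan n).P *ᵥ y) (X.ch n (t + s) ω) = _ :=
        (Setup.sum_trans_mul n y (X.chanState (t + s) ω)).symm
      rw [h2, ENNReal.ofReal_sum_of_nonneg (fun b _ => mul_nonneg (Setup.trans_nonneg _ _) (hy _))]
      exact Finset.sum_congr rfl fun b _ => (ENNReal.ofReal_mul (Setup.trans_nonneg _ _)).symm
    · intro i
      exact Finset.sum_nonneg (s := Finset.univ) fun j _ => mul_nonneg ((S.chan_ergodic n).P_nonneg i j) (hy j)

lemma measurable_comp_ch (hX : X.IsModel μ) {n : Fin N} (t : ℕ) (f : Fin (S.chan n).m → ℝ≥0∞) :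
    Measurable fun ω => f (X.ch n t ω) :=
  (Measurable.of_discrete (f := f)).comp (hX.measurable_ch n t)

lemma measurable_comp_aoi (hX : X.IsModel μ) (k : ℕ) (f : (Fin N → ℕ) → ℝ≥0∞) :
    Measurable fun ω => f (X.aoi π ω k) :=
  (Measurable.of_discrete (f := f)).comp
    ((X.measurable_aoi π k).mono (hX.sigmaOn_le _) le_rfl)

/-- On the event that the age is `a`, the error is that of the packet sent in the slot `T - a`. The
event is determined by the channels, the packet error is independent of them, and its second moment
does not depend on the slot. -/
lemma mse_eq [IsProbabilityMeasure μ] (hX : X.IsModel μ) (n : Fin N) (k : ℕ) :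
    X.mse π μ n k = ∫⁻ ω, ENNReal.ofReal ((S.plant n).errCov (X.aoi π ω k n)).trace ∂μ := by
  set T := S.start + 1 + k with hT
  -- The age never exceeds `T`, so finitely many indicators suffice.
  let ind : ℕ → Ω → ℝ≥0∞ := fun a ω => if X.aoi π ω k n = a then 1 else 0
  have hsum : ∀ (r : ℕ → ℝ≥0∞) ω, ∑ a ∈ Finset.range (T + 1), ind a ω * r a =
      r (X.aoi π ω k n) := by
    intro r ω
    obtain ⟨s, hs, -⟩ := hX.exists_xhat_sub_eq π n ω k
    simp only [ind, ite_mul, one_mul, zero_mul]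
    rw [Finset.sum_ite_eq, if_pos (Finset.mem_range.2 (by omega))]
  have hind : ∀ a, Measurable[X.sigmaOn (channelSources N)] (ind a) := by
    intro a
    have h1 : Measurable (fun φ : Fin N → ℕ => if φ n = a then (1 : ℝ≥0∞) else 0) :=
      Measurable.of_discrete
    exact h1.comp (X.measurable_aoi π k)
  have hind' : ∀ a, Measurable (ind a) := fun a => (hind a).mono (hX.sigmaOn_le _) le_rfl
  have hmeas : ∀ s j, Measurable[X.sigmaOn (pastSources n (s + j) s)]
      (fun ω => ‖X.packetErr n s j ω‖ₑ ^ 2) := by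
    intro s j
    have h0 : Measurable fun z : EuclideanSpace ℝ (Fin (S.plant n).l) => ‖z‖ₑ ^ 2 := by fun_prop
    exact h0.comp (hX.measurable_packetErr n s j)
  have hdisj : ∀ t u, Disjoint (channelSources N) (pastSources n t u) := by
    intro t u
    rw [Set.disjoint_left]
    rintro _ ⟨m, rfl⟩ ((h | ⟨s, hs, h⟩) | ⟨s, hs, h⟩) <;> simp at h
  have h1 : ∀ ω, ‖X.xhat π n ω k - X.x n T ω‖ₑ ^ 2 =
      ∑ a ∈ Finset.range (T + 1), ind a ω * ‖X.packetErr n (T - a) a ω‖ₑ ^ 2 := by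
    intro ω
    rw [hsum (fun a => ‖X.packetErr n (T - a) a ω‖ₑ ^ 2)]
    obtain ⟨s, hs, h⟩ := hX.exists_xhat_sub_eq π n ω k
    rw [hT, h, ← hs, Nat.add_sub_cancel]
  rw [mse]
  simp only [← hT, h1]
  have hmul : ∀ a, Measurable fun ω => ind a ω * ‖X.packetErr n (T - a) a ω‖ₑ ^ 2 := fun a =>
    (hind' a).mul ((hmeas _ _).mono (hX.sigmaOn_le _) le_rfl)
  rw [lintegral_finsetSum _ fun a _ => hmul a]
  have h2 : ∀ a, ∫⁻ ω, ind a ω * ‖X.packetErr n (T - a) a ω‖ₑ ^ 2 ∂μ =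
      ∫⁻ ω, ind a ω * ENNReal.ofReal ((S.plant n).errCov a).trace ∂μ := by
    intro a
    rw [lintegral_mul_eq_lintegral_mul_lintegral_of_independent_measurableSpace
      (hX.sigmaOn_le _) (hX.sigmaOn_le _) (hX.indep_sigmaOn (hdisj _ _)) (hind a) (hmeas _ _),
      (hX.hasSecondMoment_packetErr n _ a).lintegral_enorm_sq, lintegral_mul_const _ (hind' a)]
  simp only [h2]
  rw [← lintegral_finsetSum _ fun a _ => (hind' a).mul_const _]
  simp only [hsum fun a => ENNReal.ofReal ((S.plant n).errCov a).trace]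

end IsModel

end Vars

/-! ### Necessity: every policy fails at least as often as `failProb`. -/

/-- An irreducible chain visits each state within a bounded time with a probability that is bounded
away from zero. -/
lemma Channel.Ergodic.exists_sum_pow_mulVec_ge {M : ℕ} {c : Channel M} (hc : c.Ergodic) :
    ∃ (m : ℕ) (δ : ℝ), 0 < δ ∧ ∀ y : Fin c.m → ℝ, 0 ≤ y → ∀ i j,
      δ * y i ≤ ∑ s ∈ Finset.range m, (c.P ^ s *ᵥ y) j := by
  have h1 := (Matrix.isIrreducible_iff_exists_pow_pos hc.P_nonneg).1 hc.irreducible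
  choose k _ hk using h1
  obtain ⟨δ, hδ, hle⟩ := exists_pos_forall_le
    (f := fun a : Fin c.m × Fin c.m => (c.P ^ k a.1 a.2) a.1 a.2) (fun a => hk a.1 a.2)
  obtain ⟨m, hm⟩ : ∃ m, ∀ a : Fin c.m × Fin c.m, k a.1 a.2 < m := by
    obtain ⟨b, hb⟩ := (Set.finite_range fun a : Fin c.m × Fin c.m => k a.1 a.2).bddAbove
    exact ⟨b + 1, fun a => Nat.lt_succ_of_le (hb ⟨a, rfl⟩)⟩
  refine ⟨m, δ, hδ, fun y hy i j => ?_⟩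
  have hnn : ∀ s a b, 0 ≤ (c.P ^ s) a b := fun s a b =>
    nonneg_of_mem_rowStochastic (pow_mem hc.stochastic s)
  have hnn' : ∀ s, 0 ≤ (c.P ^ s *ᵥ y) j := fun s =>
    Finset.sum_nonneg (s := Finset.univ) fun b _ => mul_nonneg (hnn s j b) (hy b)
  calc δ * y i ≤ (c.P ^ k j i) j i * y i := mul_le_mul_of_nonneg_right (hle (j, i)) (hy i)
    _ ≤ (c.P ^ k j i *ᵥ y) j :=
        Finset.single_le_sum (f := fun b => (c.P ^ k j i) j b * y b)
          (fun b _ => mul_nonneg (hnn _ j b) (hy b)) (Finset.mem_univ i)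
    _ ≤ _ := Finset.single_le_sum (f := fun s => (c.P ^ s *ᵥ y) j) (fun s _ => hnn' s)
        (Finset.mem_range.2 (hm (j, i)))

/-- A sequence with a large sum over each window of length `m` has a large average. -/
lemma le_of_limsup_average_lt {f : ℕ → ℝ≥0∞} {m K : ℕ} {D B : ℝ≥0∞}
    (hD : ∀ t, K ≤ t → D ≤ ∑ s ∈ Finset.range m, f (t + s))
    (hB : limsup (fun T : ℕ => (∑ k ∈ Finset.range T, f k) / (T : ℝ≥0∞)) atTop < B) :
    D ≤ B * (1 + m) := by
  have hq : ∀ q : ℕ, q * D ≤ ∑ k ∈ Finset.range (K + q * m), f k := by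
    intro q
    induction q with
    | zero => simp
    | succ q ih =>
      rw [show K + (q + 1) * m = (K + q * m) + m by ring, Finset.sum_range_add]
      push_cast
      rw [add_mul, one_mul]
      exact add_le_add ih (hD _ (by omega))
  obtain ⟨T₀, hT₀⟩ := eventually_atTop.1 (eventually_lt_of_limsup_lt hB)
  -- Large enough to pass `T₀`, and to satisfy `K ≤ q`, so that the horizon `K + q * m` is at most
  -- `q * (1 + m)`.
  set q := K + T₀ + 1
  rcases Nat.eq_zero_or_pos m with rfl | hm
  · have := hD K le_rfl
    simp only [Finset.range_zero, Finset.sum_empty, nonpos_iff_eq_zero] at this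
    rw [this]
    exact zero_le
  have hle : T₀ ≤ K + q * m := by
    have := Nat.le_mul_of_pos_right q hm
    omega
  have h1 := (hT₀ _ hle).le
  have hne : ((K + q * m : ℕ) : ℝ≥0∞) ≠ 0 := by
    have : K + q * m ≠ 0 := by positivity
    exact_mod_cast this
  rw [ENNReal.div_le_iff hne (ENNReal.natCast_ne_top _)] at h1
  have hq0 : (q : ℝ≥0∞) ≠ 0 := by
    have : q ≠ 0 := by omega
    exact_mod_cast this
  refine (ENNReal.mul_le_mul_iff_right hq0 (ENNReal.natCast_ne_top q)).1 ((hq q).trans (h1.trans ?_))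
  have h2 : ((K + q * m : ℕ) : ℝ≥0∞) ≤ (q * (1 + m) : ℕ) := by
    norm_cast
    have : K ≤ q := by omega
    nlinarith
  calc B * ((K + q * m : ℕ) : ℝ≥0∞) ≤ B * (q * (1 + m) : ℕ) := by gcongr
    _ = q * (B * (1 + m)) := by push_cast; ring

section Necessity

variable {N M : ℕ} [NeZero M] {S : Setup N M} (π : Policy S)

/-- The least probability of `k` further consecutive failures, on the event that the age of
information of the sensor `n` is at least `c`. -/
noncomputable def failFrom (S : Setup N M) (n : Fin N) (k c : ℕ) (φ : Fin N → ℕ)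
    (h : S.State) : ℝ :=
  if c ≤ φ n then (S.chan n).failProb k (h n) else 0

lemma failFrom_nonneg (n : Fin N) (k c : ℕ) (φ : Fin N → ℕ) (h : S.State) :
    0 ≤ failFrom S n k c φ h := by
  unfold failFrom
  split_ifs
  exacts [(S.chan_ergodic n).failProb_nonneg k _, le_rfl]

/-- Given the ages and all previous channel states, the policy commits to one frequency channel `a`
for the sensor `n`, and the failure term is at least the Bellman minimum. If nothing is assigned,
failure is certain and channel `0` serves for the comparison. -/
lemma failFrom_succ_le_next (n : Fin N) (k c : ℕ) (φ : Fin N → ℕ) (h : S.State) :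
    failFrom S n (k + 1) c φ h ≤ π.next (failFrom S n k (c + 1)) φ h := by
  by_cases hc : c ≤ φ n
  · obtain ⟨a, ha⟩ : ∃ a : Fin M, ∀ h' : S.State, (S.chan n).h (h' n) a = false →
        π.recv φ h h' n = false := by
      unfold Policy.recv
      cases π.sel φ h n with
      | none => exact ⟨0, fun _ _ => rfl⟩
      | some a => exact ⟨a, fun _ h => h⟩
    rw [failFrom, if_pos hc, Channel.failProb_succ]
    refine ((S.chan n).bellman_le _ _ a).trans ?_
    have h1 : (S.chan n).failMean ((S.chan n).failProb k) (h n) a =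
        ∑ j, (S.chan n).P (h n) j *
          (if (S.chan n).h j a = true then 0 else (S.chan n).failProb k j) := by
      refine Finset.sum_congr rfl fun j _ => ?_
      split_ifs <;> simp
    rw [h1, ← Setup.sum_trans_mul]
    refine Finset.sum_le_sum fun h' _ => mul_le_mul_of_nonneg_left ?_ (Setup.trans_nonneg _ _)
    split_ifs with h2
    · exact failFrom_nonneg n k _ _ _
    · have h3 := ha h' (by simpa using h2)
      have h4 : c + 1 ≤ π.step φ h h' n := by
        rw [Policy.step, h3]
        simpa using hc
      rw [failFrom, if_pos h4]
  · rw [failFrom, if_neg hc]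
    exact Finset.sum_nonneg fun h' _ => mul_nonneg (Setup.trans_nonneg _ _)
      (failFrom_nonneg n k _ _ _)

variable {Ω : Type*} [mΩ : MeasurableSpace Ω] {μ : Measure Ω} {X : Vars S Ω}

namespace Vars.IsModel

lemma lintegral_failFrom_le (hX : X.IsModel μ) (n : Fin N) (k c j : ℕ) :
    ∫⁻ ω, ENNReal.ofReal (failFrom S n k c (X.aoi π ω j) (X.chanState (S.start + j) ω)) ∂μ ≤
      ∫⁻ ω, ENNReal.ofReal
        (failFrom S n 0 (c + k) (X.aoi π ω (j + k)) (X.chanState (S.start + (j + k)) ω)) ∂μ := by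
  induction k generalizing c j with
  | zero => exact le_rfl
  | succ k ih =>
    have h1 := ih (c + 1) (j + 1)
    have h2 := hX.lintegral_next π (failFrom_nonneg n k (c + 1)) j
    rw [show c + 1 + k = c + (k + 1) by ring, show j + 1 + k = j + (k + 1) by ring] at h1
    refine le_trans (lintegral_mono fun ω => ?_) (h2.symm.le.trans h1)
    exact ENNReal.ofReal_le_ofReal (failFrom_succ_le_next π n k c _ _)

/-- Ages are at least one, so `k` failures in a row push the age beyond `k`. -/
lemma lintegral_failProb_le (hX : X.IsModel μ) (n : Fin N) (k j : ℕ) :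
    ∫⁻ ω, ENNReal.ofReal ((S.chan n).failProb k (X.ch n (S.start + j) ω)) ∂μ ≤
      ∫⁻ ω, (if k < X.aoi π ω (j + k) n then 1 else 0) ∂μ := by
  refine le_trans (le_of_eq ?_) ((hX.lintegral_failFrom_le π n k 1 j).trans (le_of_eq ?_))
  · congr 1
    funext ω
    rw [failFrom, if_pos (X.one_le_aoi π ω j n)]
    rfl
  · congr 1
    funext ω
    simp only [failFrom, Channel.failProb_zero, Pi.one_apply, Nat.lt_iff_add_one_le,
      Nat.add_comm 1 k]
    split_ifs <;> simp

/-- The geometric sum up to the age is a sum of indicators of `i < age`; each is bounded below by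
looking back `i` slots. Truncation at `K` keeps these slots in range. -/
lemma le_mse [IsProbabilityMeasure μ] (hX : X.IsModel μ) (n : Fin N) {c r : ℝ} (hc : 0 ≤ c)
    (hr : 0 ≤ r) (h : ∀ j, c * ∑ i ∈ Finset.range j, r ^ i ≤ ((S.plant n).errCov j).trace)
    {K t : ℕ} (hK : K ≤ t) :
    ∑ i ∈ Finset.range K, ENNReal.ofReal (c * r ^ i) *
      ∫⁻ ω, ENNReal.ofReal ((S.chan n).failProb i (X.ch n (S.start + (t - i)) ω)) ∂μ ≤
      X.mse π μ n t := by
  have h1 : ∀ i ∈ Finset.range K, ENNReal.ofReal (c * r ^ i) *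
      ∫⁻ ω, ENNReal.ofReal ((S.chan n).failProb i (X.ch n (S.start + (t - i)) ω)) ∂μ ≤
      ∫⁻ ω, ENNReal.ofReal (c * r ^ i) * (if i < X.aoi π ω t n then 1 else 0) ∂μ := by
    intro i hi
    have hi' : t - i + i = t := by have := Finset.mem_range.1 hi; omega
    rw [lintegral_const_mul _
      (hX.measurable_comp_aoi π t fun φ => if i < φ n then 1 else 0)]
    have := hX.lintegral_failProb_le π n i (t - i)
    rw [hi'] at this
    gcongr
  refine (Finset.sum_le_sum h1).trans ?_
  rw [← lintegral_finsetSum _ fun i _ => (hX.measurable_comp_aoi π t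
    fun φ => ENNReal.ofReal (c * r ^ i) * if i < φ n then 1 else 0), hX.mse_eq]
  refine lintegral_mono fun ω => ?_
  refine le_trans ?_ (ENNReal.ofReal_le_ofReal (h _))
  rw [Finset.mul_sum, ENNReal.ofReal_sum_of_nonneg fun i _ => by positivity]
  simp only [mul_ite, mul_one, mul_zero]
  rw [← Finset.sum_filter]
  refine Finset.sum_le_sum_of_subset fun i hi => ?_
  rw [Finset.mem_filter] at hi
  exact Finset.mem_range.2 hi.2

/-- If the average mean-square error is finite, then the failure probabilities decay faster than
the mean-square error of the open-loop prediction grows. -/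
lemma exists_failProb_lt_of_cost_lt_top [IsProbabilityMeasure μ] (hX : X.IsModel μ) (n : Fin N)
    {c r : ℝ} (hc : 0 < c) (hr : 0 < r)
    (h : ∀ j, c * ∑ i ∈ Finset.range j, r ^ i ≤ ((S.plant n).errCov j).trace)
    (hcost : X.cost π μ n < ⊤) : ∃ k, ∀ i, r ^ k * (S.chan n).failProb k i < 1 := by
  by_contra! hcon
  -- For each `k`, a bad state with `r ^ k * failProb k ≥ 1`.
  choose i hi using hcon
  obtain ⟨m, δ, hδ, hocc⟩ := (S.chan_ergodic n).exists_sum_pow_mulVec_ge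
  obtain ⟨B, hB, hBtop⟩ := exists_between hcost
  have hVnn := (S.chan_ergodic n).failProb_nonneg
  have hocc' : ∀ k t, ENNReal.ofReal (δ * (S.chan n).failProb k (i k)) ≤
      ∑ s ∈ Finset.range m,
        ∫⁻ ω, ENNReal.ofReal ((S.chan n).failProb k (X.ch n (t + s) ω)) ∂μ := by
    intro k t
    have h1 : ∀ s, ∫⁻ ω, ENNReal.ofReal ((S.chan n).failProb k (X.ch n (t + s) ω)) ∂μ =
        ∫⁻ ω, ENNReal.ofReal (((S.chan n).P ^ s *ᵥ (S.chan n).failProb k) (X.ch n t ω)) ∂μ :=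
      fun s => hX.lintegral_ch_add n (hVnn k) t s
    simp only [h1]
    rw [← lintegral_finsetSum _ fun s _ => hX.measurable_comp_ch t
      (fun j => ENNReal.ofReal (((S.chan n).P ^ s *ᵥ (S.chan n).failProb k) j))]
    have h2 : ENNReal.ofReal (δ * (S.chan n).failProb k (i k)) =
      ∫⁻ _, ENNReal.ofReal (δ * (S.chan n).failProb k (i k)) ∂μ := by simp
    rw [h2]
    refine lintegral_mono fun ω => ?_
    rw [← ENNReal.ofReal_sum_of_nonneg fun s _ => ?_]
    · exact ENNReal.ofReal_le_ofReal (hocc _ (hVnn k) _ _)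
    · exact Finset.sum_nonneg (s := Finset.univ) fun b _ => mul_nonneg
        (nonneg_of_mem_rowStochastic (pow_mem (S.chan_ergodic n).stochastic s)) (hVnn k b)
  -- Each `k < K` contributes `c * δ` over a window whose length `m` does not depend on `K`, so
  -- letting `K` grow contradicts the finite average.
  have hwin : ∀ K t : ℕ, K ≤ t → ENNReal.ofReal (K * (c * δ)) ≤
      ∑ s ∈ Finset.range m, X.mse π μ n (t + s) := by
    intro K t hKt
    refine le_trans ?_ (Finset.sum_le_sum fun s _ =>
      hX.le_mse π n hc.le hr.le h (K := K) (t := t + s) (by omega))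
    rw [Finset.sum_comm]
    have h3 : ENNReal.ofReal (K * (c * δ)) = ∑ _k ∈ Finset.range K, ENNReal.ofReal (c * δ) := by
      rw [Finset.sum_const, Finset.card_range, nsmul_eq_mul, ENNReal.ofReal_mul (by positivity)]
      simp
    rw [h3]
    refine Finset.sum_le_sum fun k hk => ?_
    rw [← Finset.mul_sum]
    have h4 := hocc' k (S.start + (t - k))
    have h5 : ∀ s, S.start + (t - k) + s = S.start + (t + s - k) := by
      have := Finset.mem_range.1 hk
      intro s; omega
    simp only [h5] at h4
    refine le_trans ?_ (mul_le_mul_right h4 _)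
    rw [← ENNReal.ofReal_mul (by positivity)]
    refine ENNReal.ofReal_le_ofReal ?_
    have h6 := hi k
    have : 0 < c * δ := by positivity
    nlinarith
  have hall : ∀ K : ℕ, (K : ℝ) * (c * δ) ≤ (B * (1 + m)).toReal := by
    intro K
    refine (ENNReal.ofReal_le_iff_le_toReal (ENNReal.mul_ne_top hBtop.ne (by finiteness))).1 ?_
    exact le_of_limsup_average_lt (hwin K) hB
  obtain ⟨K, hK⟩ := exists_nat_gt ((B * (1 + m)).toReal / (c * δ))
  rw [div_lt_iff₀ (by positivity)] at hK
  linarith [hall K]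

lemma specRad_sq_mul_lamInf_lt_one [IsProbabilityMeasure μ] (hX : X.IsModel μ) (n : Fin N)
    (hcost : X.cost π μ n < ⊤) : specRad (S.plant n).A ^ 2 * (S.chan n).lamInf < 1 := by
  have hlam0 := (S.chan_ergodic n).lamInf_nonneg
  have hlam1 := (S.chan_ergodic n).lamInf_le_one
  have hρ := specRad_nonneg (S.plant n).A
  rcases lt_or_ge (specRad (S.plant n).A) 1 with h1 | h1
  -- A stable process needs only `lamInf ≤ 1`.
  · have : specRad (S.plant n).A ^ 2 < 1 := by nlinarith
    nlinarith
  obtain ⟨c, hc, hle⟩ := (S.plant_steady n).exists_le_trace_errCov h1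
  set r := specRad (S.plant n).A ^ 2
  have hr : 0 < r := by positivity
  obtain ⟨k, hk⟩ := hX.exists_failProb_lt_of_cost_lt_top π n hc hr hle hcost
  have : Nonempty Ω := nonempty_of_isProbabilityMeasure μ
  have : Nonempty (Fin (S.chan n).m) := ⟨X.ch n 0 (Classical.arbitrary Ω)⟩
  have hk0 : k ≠ 0 := by
    rintro rfl
    simpa [Channel.failProb_zero] using hk (Classical.arbitrary _)
  obtain ⟨i, hi⟩ := exists_eq_ciSup_of_finite (f := (S.chan n).failProb k)
  set b := (S.chan n).failProb k i
  have hb : 0 ≤ b := (S.chan_ergodic n).failProb_nonneg k i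
  have hmax : ∀ j, (S.chan n).failProb k j ≤ b := fun j =>
    hi ▸ le_ciSup (Set.finite_range _).bddAbove j
  -- The `k`-th root of the worst failure probability, so that `r ^ k * b < 1` becomes `r * θ < 1`.
  set θ := b ^ ((k : ℝ)⁻¹)
  have hθk : θ ^ k = b := Real.rpow_inv_natCast_pow hb hk0
  have hθ : 0 ≤ θ := Real.rpow_nonneg hb _
  have h2 := (S.chan_ergodic n).lamInf_le_of_failProb_le (Nat.pos_of_ne_zero hk0) hθ
    (fun j => (hmax j).trans hθk.ge)
  have h3 : (r * θ) ^ k < 1 := by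
    rw [mul_pow, hθk]
    exact hk i
  have h4 : r * θ < 1 := by
    by_contra! hcon
    exact absurd (one_le_pow₀ hcon (n := k)) (not_le.2 h3)
  exact (mul_le_mul_of_nonneg_left h2 hr.le).trans_lt h4

end Vars.IsModel

end Necessity

/-! ### Priorities and ranks by age. -/

section Key

variable {N : ℕ}

/-- The scheduling priority of a sensor: the age of information, with ties broken by the index. -/
def key (φ : Fin N → ℕ) (n : Fin N) : ℕ := φ n * N + n

lemma key_injective (φ : Fin N → ℕ) : Function.Injective (key φ) := by
  intro a b h
  have h1 : (key φ a) % N = (key φ b) % N := by rw [h]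
  simp only [key, Nat.mul_add_mod_self_right] at h1
  rw [Nat.mod_eq_of_lt a.2, Nat.mod_eq_of_lt b.2] at h1
  exact Fin.ext h1

/-- The number of sensors of higher priority. -/
def rank (φ : Fin N → ℕ) (n : Fin N) : ℕ :=
  (Finset.univ.filter fun n' => key φ n < key φ n').card

lemma key_add_one (φ : Fin N → ℕ) (n : Fin N) : key (fun n => φ n + 1) n = key φ n + N := by
  simp only [key, add_mul, one_mul]
  omega

lemma rank_add_one (φ : Fin N → ℕ) (n : Fin N) : rank (fun n => φ n + 1) n = rank φ n := by
  simp only [rank, key_add_one, add_lt_add_iff_right]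

lemma rank_le (φ : Fin N → ℕ) (n : Fin N) : rank φ n ≤ N :=
  (Finset.card_le_univ _).trans (by simp)

/-- Serving the sensor of the highest priority moves the other sensors up. -/
lemma rank_serve_add_one_le {φ : Fin N → ℕ} (hφ : ∀ n, 1 ≤ φ n) {s n : Fin N}
    (hs : ∀ n, key φ n ≤ key φ s) (hn : n ≠ s) :
    rank (fun n => if n = s then 1 else φ n + 1) n + 1 ≤ rank φ n := by
  refine Finset.card_lt_card ?_
  rw [Finset.ssubset_iff_of_subset]
  · refine ⟨s, ?_, ?_⟩
    · simp only [Finset.mem_filter, Finset.mem_univ, true_and]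
      exact lt_of_le_of_ne (hs n) fun h => hn (key_injective φ h)
    · simp only [Finset.mem_filter, Finset.mem_univ, true_and, key, if_neg hn, if_true, add_mul,
        one_mul]
      -- After service the key of `s` is `N + s < 2 * N`, while that of `n` is at least `2 * N`; so
      -- `s` leaves the set of sensors ahead of `n`.
      have h1 : N ≤ φ n * N := Nat.le_mul_of_pos_left N (hφ n)
      have := s.2
      omega
  · intro n' h'
    rw [Finset.mem_filter] at h' ⊢
    refine ⟨Finset.mem_univ _, ?_⟩
    by_cases h : n' = s
    · rw [h]
      exact lt_of_le_of_ne (hs n) fun h => hn (key_injective φ h)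
    · have h1 := h'.2
      simp only [key, if_neg hn, if_neg h, add_mul, one_mul] at h1 ⊢
      omega

end Key

/-! ### Sufficiency: serving the oldest sensor and the Lyapunov drift. -/

section Sufficiency

variable {N M : ℕ} {S : Setup N M}

/-- The policy that schedules only the sensor of the largest age of information, on a frequency
channel that depends on its previous channel state. -/
def oldestFirst (S : Setup N M) (v : (n : Fin N) → Fin (S.chan n).m → Fin M) : Policy S where
  sel φ h n := if ∀ n', key φ n' ≤ key φ n then some (v n (h n)) else none
  exclusive φ h n n' m h1 h2 := by
    have h3 : ∀ a, key φ a ≤ key φ n := by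
      by_contra hc
      simp [hc] at h1
    have h4 : ∀ a, key φ a ≤ key φ n' := by
      by_contra hc
      simp [hc] at h2
    exact key_injective φ (le_antisymm (h4 n) (h3 n'))

/-- The weighted sum of the exponentials of the ages of information. -/
noncomputable def ageSum (B γ : ℝ) (φ : Fin N → ℕ) : ℝ := ∑ n, B ^ rank φ n * γ ^ φ n

/-- The Lyapunov function of the policy `oldestFirst`. -/
noncomputable def lyapunov (W : (n : Fin N) → Fin (S.chan n).m → ℝ) (B γ : ℝ)
    (φ : Fin N → ℕ) (h : S.State) : ℝ :=
  (∑ s, if ∀ n, key φ n ≤ key φ s then W s (h s) else 0) * ageSum B γ φ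

variable {v : (n : Fin N) → Fin (S.chan n).m → Fin M} {W : (n : Fin N) → Fin (S.chan n).m → ℝ}
  {B γ : ℝ}

lemma sum_top {φ : Fin N → ℕ} {s : Fin N} (hs : ∀ n, key φ n ≤ key φ s) (f : Fin N → ℝ) :
    (∑ s, if ∀ n, key φ n ≤ key φ s then f s else 0) = f s := by
  rw [Finset.sum_eq_single s, if_pos hs]
  · intro n _ hn
    rw [if_neg]
    exact fun h => hn (key_injective φ (le_antisymm (hs n) (h s)))
  · simp

lemma exists_top (φ : Fin N → ℕ) (n : Fin N) : ∃ s, ∀ n, key φ n ≤ key φ s := by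
  obtain ⟨s, -, hs⟩ := Finset.exists_max_image Finset.univ (key φ) ⟨n, Finset.mem_univ _⟩
  exact ⟨s, fun n => hs n (Finset.mem_univ _)⟩

lemma lyapunov_eq {φ : Fin N → ℕ} {s : Fin N} (hs : ∀ n, key φ n ≤ key φ s) (h : S.State) :
    lyapunov W B γ φ h = W s (h s) * ageSum B γ φ := by
  rw [lyapunov, sum_top hs fun s => W s (h s)]

lemma ageSum_nonneg (hB : 0 ≤ B) (hγ : 0 ≤ γ) (φ : Fin N → ℕ) : 0 ≤ ageSum B γ φ :=
  Finset.sum_nonneg fun _ _ => by positivity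

lemma ageSum_add_one (φ : Fin N → ℕ) :
    ageSum B γ (fun n => φ n + 1) = γ * ageSum B γ φ := by
  simp only [ageSum, rank_add_one, Finset.mul_sum]
  exact Finset.sum_congr rfl fun n _ => by ring

/-- Each unserved sensor moves up by at least one rank, which gains `1 / B` against the factor `γ`
of ageing. The served sensor has age one and weight at most `B ^ N`. -/
lemma ageSum_serve_le (hB : 1 ≤ B) (hγ : 0 ≤ γ) {φ : Fin N → ℕ} (hφ : ∀ n, 1 ≤ φ n) {s : Fin N}
    (hs : ∀ n, key φ n ≤ key φ s) :
    ageSum B γ (fun n => if n = s then 1 else φ n + 1) ≤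
      γ / B * ageSum B γ φ + γ * B ^ N := by
  have hB0 : 0 < B := by linarith
  have h1 : ∀ n, B ^ rank (fun n => if n = s then 1 else φ n + 1) n *
      γ ^ (if n = s then 1 else φ n + 1) ≤
      γ / B * (B ^ rank φ n * γ ^ φ n) + if n = s then γ * B ^ N else 0 := by
    intro n
    split_ifs with hn
    · have h2 : B ^ rank (fun n => if n = s then 1 else φ n + 1) n ≤ B ^ N :=
        pow_le_pow_right₀ hB (rank_le _ _)
      have h3 : 0 ≤ γ / B * (B ^ rank φ n * γ ^ φ n) := by positivity
      rw [pow_one]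
      nlinarith
    · rw [add_zero, div_mul_eq_mul_div, le_div_iff₀ hB0]
      have h2 : B ^ (rank (fun n => if n = s then 1 else φ n + 1) n + 1) ≤ B ^ rank φ n :=
        pow_le_pow_right₀ hB (rank_serve_add_one_le hφ hs hn)
      have h3 : 0 ≤ γ ^ (φ n + 1) := by positivity
      calc _ = B ^ (rank (fun n => if n = s then 1 else φ n + 1) n + 1) * γ ^ (φ n + 1) := by ring
        _ ≤ B ^ rank φ n * γ ^ (φ n + 1) := mul_le_mul_of_nonneg_right h2 h3
        _ = _ := by ring
  refine (Finset.sum_le_sum fun n _ => h1 n).trans (le_of_eq ?_)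
  rw [Finset.sum_add_distrib, ← Finset.mul_sum, Finset.sum_ite_eq' Finset.univ s,
    if_pos (Finset.mem_univ s), ageSum]

lemma recv_oldestFirst {φ : Fin N → ℕ} {s : Fin N} (hs : ∀ n, key φ n ≤ key φ s)
    (h h' : S.State) (n : Fin N) : (oldestFirst S v).recv φ h h' n =
      (decide (n = s) && (S.chan s).h (h' s) (v s (h s))) := by
  by_cases hn : n = s
  · subst hn
    simp [Policy.recv, oldestFirst, hs]
  · have : ¬ ∀ n', key φ n' ≤ key φ n := fun h =>
      hn (key_injective φ (le_antisymm (hs n) (h s)))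
    simp [Policy.recv, oldestFirst, this, hn]

lemma step_oldestFirst {φ : Fin N → ℕ} {s : Fin N} (hs : ∀ n, key φ n ≤ key φ s)
    (h h' : S.State) : (oldestFirst S v).step φ h h' =
      if (S.chan s).h (h' s) (v s (h s)) = true then fun n => if n = s then 1 else φ n + 1
      else fun n => φ n + 1 := by
  funext n
  rw [Policy.step, recv_oldestFirst hs]
  split_ifs <;> simp_all

lemma lyapunov_nonneg (hW : ∀ n i, 1 ≤ W n i) (hB : 0 ≤ B) (hγ : 0 ≤ γ) (φ : Fin N → ℕ)
    (h : S.State) : 0 ≤ lyapunov W B γ φ h := by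
  refine mul_nonneg (Finset.sum_nonneg fun s _ => ?_) (ageSum_nonneg hB hγ φ)
  split_ifs
  exacts [zero_le_one.trans (hW _ _), le_rfl]

lemma pow_le_lyapunov (hW : ∀ n i, 1 ≤ W n i) (hB : 1 ≤ B) (hγ : 0 ≤ γ) (φ : Fin N → ℕ)
    (h : S.State) (n : Fin N) : γ ^ φ n ≤ lyapunov W B γ φ h := by
  obtain ⟨s, hs⟩ := exists_top φ n
  have hB0 : 0 ≤ B := by linarith
  rw [lyapunov_eq hs]
  have h1 : γ ^ φ n ≤ ageSum B γ φ := by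
    refine le_trans ?_ (Finset.single_le_sum (f := fun n => B ^ rank φ n * γ ^ φ n)
      (fun n _ => by positivity) (Finset.mem_univ n))
    exact le_mul_of_one_le_left (by positivity) (one_le_pow₀ hB)
  exact h1.trans (le_mul_of_one_le_left (ageSum_nonneg hB0 hγ φ) (hW _ _))

/-- The drift condition. -/
lemma next_lyapunov_le {q C : ℝ} (hW : ∀ n i, 1 ≤ W n i) (hWC : ∀ n i, W n i ≤ C)
    (hq : ∀ n i, (S.chan n).failMean (W n) i (v n i) ≤ q * W n i) (hB : 1 ≤ B) (hγ : 0 ≤ γ)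
    {φ : Fin N → ℕ} (hφ : ∀ n, 1 ≤ φ n) (h : S.State) (n : Fin N) :
    (oldestFirst S v).next (lyapunov W B γ) φ h ≤
      (γ * q + C * γ / B) * lyapunov W B γ φ h + C * γ * B ^ N := by
  obtain ⟨s, hs⟩ := exists_top φ n
  have hB0 : 0 < B := by linarith
  have hC : 0 ≤ C := by linarith [hW n (h n), hWC n (h n)]
  set a := ageSum B γ φ with ha
  have ha0 : 0 ≤ a := ageSum_nonneg hB0.le hγ φ
  have h1 : ∀ h' : S.State, lyapunov W B γ ((oldestFirst S v).step φ h h') h' ≤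
      (γ * a) * (if (S.chan s).h (h' s) (v s (h s)) = true then 0 else W s (h' s)) +
        C * (γ / B * a + γ * B ^ N) := by
    intro h'
    rw [step_oldestFirst hs]
    split_ifs with hr
    -- After a success another sensor may be the oldest, and its `W` is only known to be at most
    -- `C`; the factor `1 / B` will pay for this.
    · obtain ⟨s', hs'⟩ := exists_top (fun n => if n = s then 1 else φ n + 1) n
      rw [lyapunov_eq hs', mul_zero, zero_add]
      exact mul_le_mul (hWC _ _) (ageSum_serve_le hB hγ hφ hs) (ageSum_nonneg hB0.le hγ _) hC
    -- After a failure the oldest sensor stays the oldest, so the contraction of its `W` applies.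
    · have hs' : ∀ n, key (fun n => φ n + 1) n ≤ key (fun n => φ n + 1) s := fun n => by
        rw [key_add_one, key_add_one]
        exact Nat.add_le_add_right (hs n) N
      rw [lyapunov_eq hs', ageSum_add_one, mul_comm]
      exact le_add_of_nonneg_right (by positivity)
  have h2 : (oldestFirst S v).next (lyapunov W B γ) φ h ≤
      (γ * a) * (S.chan s).failMean (W s) (h s) (v s (h s)) + C * (γ / B * a + γ * B ^ N) := by
    refine (Finset.sum_le_sum fun h' _ => mul_le_mul_of_nonneg_left (h1 h')
      (Setup.trans_nonneg _ _)).trans ?_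
    simp only [mul_add (S.trans _ _), Finset.sum_add_distrib]
    rw [← Finset.sum_mul]
    have h3 : (S.chan s).failMean (W s) (h s) (v s (h s)) =
        ∑ j, (S.chan s).P (h s) j *
          (if (S.chan s).h j (v s (h s)) = true then 0 else W s j) := by
      refine Finset.sum_congr rfl fun j _ => ?_
      split_ifs <;> simp
    rw [h3, ← Setup.sum_trans_mul s
      (fun j => if (S.chan s).h j (v s (h s)) = true then 0 else W s j) h, Finset.mul_sum]
    refine add_le_add (Finset.sum_le_sum fun h' _ => le_of_eq (by ring)) ?_
    exact mul_le_of_le_one_left (by positivity) (Setup.sum_trans_le_one h)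
  rw [lyapunov_eq hs]
  refine h2.trans ?_
  have h4 := mul_le_mul_of_nonneg_left (hq s (h s)) (mul_nonneg hγ ha0)
  have h5 : C * γ / B * a ≤ C * γ / B * (W s (h s) * a) :=
    mul_le_mul_of_nonneg_left (le_mul_of_one_le_left ha0 (hW _ _)) (by positivity)
  have h6 : C * (γ / B * a + γ * B ^ N) = C * γ / B * a + C * γ * B ^ N := by ring
  rw [h6]
  linarith

lemma ofReal_mul_add_iterate_le {a : ℕ → ℝ≥0∞} {θ D : ℝ} (hθ0 : 0 ≤ θ) (hθ : θ < 1) (hD : 0 ≤ D)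
    (h : ∀ k, a (k + 1) ≤ ENNReal.ofReal θ * a k + ENNReal.ofReal D) (k : ℕ) :
    a k ≤ a 0 + ENNReal.ofReal (D / (1 - θ)) := by
  induction k with
  | zero => exact le_self_add
  | succ k ih =>
    have h1 : 0 < 1 - θ := by linarith
    calc a (k + 1) ≤ ENNReal.ofReal θ * (a 0 + ENNReal.ofReal (D / (1 - θ))) +
          ENNReal.ofReal D := (h k).trans (by gcongr)
      _ = ENNReal.ofReal θ * a 0 + ENNReal.ofReal (D / (1 - θ)) := by
          rw [mul_add, add_assoc, ← ENNReal.ofReal_mul hθ0,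
            ← ENNReal.ofReal_add (by positivity) hD]
          congr 2
          field_simp
          ring
      _ ≤ 1 * a 0 + ENNReal.ofReal (D / (1 - θ)) := by
          gcongr
          rw [ENNReal.ofReal_le_one]
          exact hθ.le
      _ = _ := by rw [one_mul]

variable {Ω : Type*} [mΩ : MeasurableSpace Ω] {μ : Measure Ω} {X : Vars S Ω}

namespace Vars

lemma cost_le_of_mse_le {π : Policy S} {n : Fin N} {b : ℝ≥0∞} (h : ∀ k, X.mse π μ n k ≤ b) :
    X.cost π μ n ≤ b := by
  refine limsup_le_of_le (by isBoundedDefault) (Eventually.of_forall fun T => ?_)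
  refine ENNReal.div_le_of_le_mul ((Finset.sum_le_sum fun k _ => h k).trans (le_of_eq ?_))
  rw [Finset.sum_const, Finset.card_range, nsmul_eq_mul, mul_comm]

lemma stabilizable_of_mse_le {π : Policy S}
    (h : ∀ n, ∃ b : ℝ≥0∞, b < ⊤ ∧ ∀ k, X.mse π μ n k ≤ b) : X.Stabilizable μ := by
  refine ⟨π, ENNReal.sum_lt_top.2 fun n _ => ?_⟩
  obtain ⟨b, hb, hle⟩ := h n
  exact (cost_le_of_mse_le hle).trans_lt hb

variable [IsProbabilityMeasure μ]

/-- Without any transmission the error covariances stay bounded by a convergent geometric series. -/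
lemma IsModel.stabilizable_of_forall_specRad_lt_one (hX : X.IsModel μ)
    (h : ∀ n, specRad (S.plant n).A < 1) : X.Stabilizable μ := by
  let π : Policy S := ⟨fun _ _ _ => none, fun _ _ _ _ _ h => by simp at h⟩
  refine stabilizable_of_mse_le (π := π) fun n => ?_
  have h0 := specRad_nonneg (S.plant n).A
  have h1 : specRad (S.plant n).A ^ 2 < 1 := by nlinarith [h n]
  obtain ⟨γ, hγ, hγ1⟩ := exists_between h1
  have hγ0 : 0 ≤ γ := (sq_nonneg _).trans hγ.le
  obtain ⟨C, hC, hle⟩ := (S.plant_steady n).exists_trace_errCov_le hγ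
  refine ⟨ENNReal.ofReal (C * (1 - γ)⁻¹), ENNReal.ofReal_lt_top, fun k => ?_⟩
  rw [hX.mse_eq]
  refine (lintegral_mono (g := fun _ => ENNReal.ofReal (C * (1 - γ)⁻¹)) fun ω =>
    ENNReal.ofReal_le_ofReal ((hle _).trans ?_)).trans (by simp)
  refine mul_le_mul_of_nonneg_left ?_ hC.le
  rw [← tsum_geometric_of_lt_one hγ0 hγ1]
  exact (summable_geometric_of_lt_one hγ0 hγ1).sum_le_tsum _ fun _ _ => by positivity

lemma IsModel.stabilizable_of_contracting (hX : X.IsModel μ) {γ q : ℝ} (hγ1 : 1 < γ)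
    (hq0 : 0 ≤ q) (hγq : γ * q < 1) (hγ : ∀ n, specRad (S.plant n).A ^ 2 < γ)
    (hW : ∀ n i, 1 ≤ W n i)
    (hq : ∀ n i, (S.chan n).failMean (W n) i (v n i) ≤ q * W n i) : X.Stabilizable μ := by
  obtain ⟨C, hC⟩ : ∃ C, ∀ a : (n : Fin N) × Fin (S.chan n).m, W a.1 a.2 ≤ C := by
    obtain ⟨C, hC⟩ := (Set.finite_range fun a : (n : Fin N) × Fin (S.chan n).m =>
      W a.1 a.2).bddAbove
    exact ⟨C, fun a => hC ⟨a, rfl⟩⟩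
  set C' := max C 1
  have hWC : ∀ n i, W n i ≤ C' := fun n i => (hC ⟨n, i⟩).trans (le_max_left _ _)
  have hC1 : 1 ≤ C' := le_max_right _ _
  set ε := (1 - γ * q) / 2 with hε
  have hε0 : 0 < ε := by rw [hε]; linarith
  -- Chosen so that `C' * γ / B ≤ ε`, half the gap between `γ * q` and one.
  set B := C' * γ / ε + 1 with hB
  have hB1 : 1 ≤ B := by
    have : 0 ≤ C' * γ / ε := by positivity
    linarith
  have hB0 : 0 < B := by linarith
  have hθ : γ * q + C' * γ / B < 1 := by
    have : C' * γ / B ≤ ε := by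
      rw [div_le_iff₀ hB0, hB, mul_add, mul_div_cancel₀ _ hε0.ne']
      linarith
    linarith
  have hγ0 : 0 ≤ γ := by linarith
  set D := C' * γ * B ^ N
  set π := oldestFirst S v
  let a : ℕ → ℝ≥0∞ := fun k =>
    ∫⁻ ω, ENNReal.ofReal (lyapunov W B γ (X.aoi π ω k) (X.chanState (S.start + k) ω)) ∂μ
  have hnn := lyapunov_nonneg (S := S) hW hB0.le hγ0
  refine stabilizable_of_mse_le (π := π) fun n => ?_
  have hmeas : ∀ k, Measurable fun ω =>
      ENNReal.ofReal (lyapunov W B γ (X.aoi π ω k) (X.chanState (S.start + k) ω)) := by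
    intro k
    obtain ⟨F, hF⟩ := X.exists_aoi_eq π k
    have h1 : Measurable fun g : Fin (S.start + k + 1) → S.State =>
      ENNReal.ofReal (lyapunov W B γ (F g) (g (Fin.last _))) := Measurable.of_discrete
    simp only [hF]
    exact h1.comp (hX.measurable_hist (S.start + k))
  have hstep : ∀ k, a (k + 1) ≤ ENNReal.ofReal (γ * q + C' * γ / B) * a k + ENNReal.ofReal D := by
    intro k
    have h1 : a (k + 1) = _ := hX.lintegral_next π hnn k
    rw [h1]
    have h2 : ∀ ω, ENNReal.ofReal (π.next (lyapunov W B γ) (X.aoi π ω k)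
        (X.chanState (S.start + k) ω)) ≤ ENNReal.ofReal (γ * q + C' * γ / B) *
          ENNReal.ofReal (lyapunov W B γ (X.aoi π ω k) (X.chanState (S.start + k) ω)) +
          ENNReal.ofReal D := by
      intro ω
      rw [← ENNReal.ofReal_mul (by positivity),
        ← ENNReal.ofReal_add (mul_nonneg (by positivity) (hnn _ _)) (by positivity)]
      exact ENNReal.ofReal_le_ofReal
        (next_lyapunov_le hW hWC hq hB1 hγ0 (X.one_le_aoi π ω k) _ n)
    refine (lintegral_mono h2).trans (le_of_eq ?_)
    rw [lintegral_add_right _ measurable_const, lintegral_const_mul _ (hmeas k)]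
    simp [a]
  have ha0 : a 0 < ⊤ := by
    obtain ⟨b, hb⟩ := (Set.finite_range fun h : S.State =>
      lyapunov W B γ (fun n => S.start + 1 - S.last n) h).bddAbove
    refine (lintegral_mono (g := fun _ => ENNReal.ofReal b) fun ω =>
      ENNReal.ofReal_le_ofReal (hb ⟨_, rfl⟩)).trans_lt ?_
    simp
  obtain ⟨K, hK, hle⟩ := (S.plant_steady n).exists_trace_errCov_le (hγ n)
  have hbd := ofReal_mul_add_iterate_le (a := a) (by positivity) hθ (by positivity) hstep
  -- The geometric sum up to exponent `φ` is at most `γ / (γ - 1) * γ ^ φ`, and `γ ^ φ` is dominated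
  -- by the Lyapunov function.
  refine ⟨ENNReal.ofReal (K * (γ / (γ - 1))) *
    (a 0 + ENNReal.ofReal (D / (1 - (γ * q + C' * γ / B)))),
    ENNReal.mul_lt_top ENNReal.ofReal_lt_top (ENNReal.add_lt_top.2 ⟨ha0, ENNReal.ofReal_lt_top⟩),
    fun k => le_trans ?_ (mul_le_mul_right (hbd k) _)⟩
  rw [hX.mse_eq, ← lintegral_const_mul _ (hmeas k)]
  refine lintegral_mono fun ω => ?_
  have hγ' : 0 < γ - 1 := by linarith
  rw [← ENNReal.ofReal_mul (by positivity)]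
  refine ENNReal.ofReal_le_ofReal ((hle _).trans ?_)
  rw [mul_assoc]
  refine mul_le_mul_of_nonneg_left ?_ hK.le
  refine le_trans ?_ (mul_le_mul_of_nonneg_left
    (pow_le_lyapunov hW hB1 hγ0 (X.aoi π ω k) (X.chanState (S.start + k) ω) n) (by positivity))
  rw [geom_sum_eq hγ1.ne', div_mul_eq_mul_div]
  gcongr
  rw [pow_succ']
  linarith

end Vars

end Sufficiency

end RemoteEst

theorem theorem5 {N M : ℕ} (hM : 0 < M) (S : RemoteEst.Setup N M)
    {Ω : Type*} [MeasurableSpace Ω] (μ : MeasureTheory.Measure Ω)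
    [MeasureTheory.IsProbabilityMeasure μ] (X : RemoteEst.Vars S Ω) (hX : X.IsModel μ) :
    (X.Stabilizable μ →
      (⨆ n, RemoteEst.specRad (S.plant n).A ^ 2 * (S.chan n).lamInf) < 1) ∧
    ((⨆ n, RemoteEst.specRad (S.plant n).A) ^ 2 * (⨆ n, (S.chan n).lamInf) < 1 →
      X.Stabilizable μ) := by
  have : NeZero M := ⟨hM.ne'⟩
  have hlam : ∀ n, (S.chan n).lamInf ≤ ⨆ n, (S.chan n).lamInf :=
    le_ciSup (Set.finite_range _).bddAbove
  have hrad : ∀ n, RemoteEst.specRad (S.plant n).A ≤ ⨆ n, RemoteEst.specRad (S.plant n).A :=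
    le_ciSup (Set.finite_range _).bddAbove
  constructor
  · rintro ⟨π, hπ⟩
    rcases isEmpty_or_nonempty (Fin N) with hN | hN
    · rw [Real.iSup_of_isEmpty]
      exact one_pos
    · obtain ⟨n, hn⟩ := exists_eq_ciSup_of_finite
        (f := fun n => RemoteEst.specRad (S.plant n).A ^ 2 * (S.chan n).lamInf)
      rw [← hn]
      exact hX.specRad_sq_mul_lamInf_lt_one π n
        (ENNReal.sum_lt_top.1 hπ n (Finset.mem_univ n))
  · intro h
    set ρ := ⨆ n, RemoteEst.specRad (S.plant n).A
    set l := ⨆ n, (S.chan n).lamInf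
    -- The Lyapunov argument needs `γ > 1`, which `γ > ρ ^ 2` ensures only when `ρ ≥ 1`.
    rcases lt_or_ge ρ 1 with hρ | hρ
    · exact hX.stabilizable_of_forall_specRad_lt_one fun n => (hrad n).trans_lt hρ
    have hl0 : 0 ≤ l := Real.iSup_nonneg fun n => (S.chan_ergodic n).lamInf_nonneg
    have hl1 : l ≤ 1 := Real.iSup_le (fun n => (S.chan_ergodic n).lamInf_le_one) zero_le_one
    -- Half the gap `1 - ρ ^ 2 * l` may be added to `ρ ^ 2` because `l ≤ 1`. Working with `γ`
    -- instead of `1 / l` also covers `l = 0`.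
    obtain ⟨γ, hγ, hγl⟩ : ∃ γ, ρ ^ 2 < γ ∧ γ * l < 1 :=
      ⟨ρ ^ 2 + (1 - ρ ^ 2 * l) / 2, by linarith, by nlinarith⟩
    have hγ1 : 1 < γ := by nlinarith
    obtain ⟨q, hlq, hq⟩ := exists_between ((lt_div_iff₀' (by linarith)).2 hγl)
    rw [lt_div_iff₀' (by linarith)] at hq
    choose v W hW hvW using fun n => (S.chan_ergodic n).exists_contracting ((hlam n).trans_lt hlq)
    refine hX.stabilizable_of_contracting hγ1 (hl0.trans hlq.le) hq (fun n => ?_) hW hvW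
    have := RemoteEst.specRad_nonneg (S.plant n).A
    nlinarith [hrad n]
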